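/- Let $\mathcal{F}$ be a field of characteristic $2$, let $p\in\mathcal{F}[x]$ be a monic irreducible polynomial of degree $d$, and let $\mathcal{F}(p)=\mathcal{F}[x]/(p)$. For a field $K$ of characteristic $2$, let $W(K)$ be the Witt ring of nondegenerate symmetric bilinear forms over $K$, let $I(K)\subset W(K)$ be the fundamental ideal (the classes of even-dimensional forms), let $W_q(K)$ be the Witt group of nonsingular quadratic forms over $K$ (those with nondegenerate polar form), regarded as a $W(K)$-module through the tensor product, and for $m\ge 1$ let $I_q^m(K)=I(K)^{m-1}\cdot W_q(K)\subseteq W_q(K)$ be the subgroup generated by the products of an element of $I(K)^{m-1}$ and an element of $W_q(K)$, where $I(K)^0=W(K)$; thus $I_q^1(K)=W_q(K)$. Let $t_p:\mathcal{F}(p)\to\mathcal{F}$ be the $\mathcal{F}$-linear map with $t_p(x^i)=0$ for $0\le i\le d-2$ and $t_p(x^{d-1})=1$, and let $t_p':W_q(\mathcal{F}(p))\to W_q(\mathcal{F})$ be the Scharlau transfer induced by $t_p$: the group homomorphism that sends the class of a nonsingular quadratic form $q$ on an $\mathcal{F}(p)$-vector space $V$ to the class of $t_p\circ q$ on $V$,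 viewed as an $\mathcal{F}$-vector space. Then $$t_p'\bigl(I_q^m(\mathcal{F}(p))\bigr)\subseteq I_q^m(\mathcal{F})\qquad\text{for all } m\ge 1 .$$ -/

import Mathlib

noncomputable section

namespace WittTheory

open TensorProduct
open LinearMap (BilinForm)

universe u

section Forms

variable {F : Type*} [Field F]
variable {V : Type*} [AddCommGroup V] [Module F V]
variable {W : Type*} [AddCommGroup W] [Module F W]
variable {V' : Type*} [AddCommGroup V'] [Module F V']
variable {W' : Type*} [AddCommGroup W'] [Module F W']

/-- The orthogonal sum of two bilinear forms. -/
def bilinSum (B : BilinForm F V) (C : BilinForm F W) : BilinForm F (V × W) :=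
  B.compl₁₂ (LinearMap.fst F V W) (LinearMap.fst F V W) +
    C.compl₁₂ (LinearMap.snd F V W) (LinearMap.snd F V W)

@[simp]
theorem bilinSum_apply (B : BilinForm F V) (C : BilinForm F W) (x y : V × W) :
    bilinSum B C x y = B x.1 y.1 + C x.2 y.2 := rfl

theorem nondeg_of_symm {B : BilinForm F V} (hs : ∀ x y, B x y = B y x)
    (h : ∀ x, (∀ y, B x y = 0) → x = 0) : B.Nondegenerate :=
  ⟨h, fun y hy => h y fun x => by rw [hs]; exact hy x⟩

theorem bilinSum_nondegenerate {B : BilinForm F V} {C : BilinForm F W}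
    (hB : B.Nondegenerate) (hC : C.Nondegenerate) : (bilinSum B C).Nondegenerate := by
  constructor
  · intro x hx
    refine Prod.ext (hB.1 _ fun y => ?_) (hC.1 _ fun y => ?_)
    · simpa using hx (y, 0)
    · simpa using hx (0, y)
  · intro x hx
    refine Prod.ext (hB.2 _ fun y => ?_) (hC.2 _ fun y => ?_)
    · simpa using hx (y, 0)
    · simpa using hx (0, y)

theorem tmul_apply (B : BilinForm F V) (C : BilinForm F W) (v v' : V) (w w' : W) :
    B.tmul C (v ⊗ₜ w) (v' ⊗ₜ w') = B v v' * C w w' := by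
  rw [LinearMap.BilinForm.tensorDistrib_tmul, smul_eq_mul, mul_comm]

theorem tmul_separatingLeft [FiniteDimensional F V] [FiniteDimensional F W]
    {B : BilinForm F V} {C : BilinForm F W}
    (hB : B.Nondegenerate) (hC : C.Nondegenerate) :
    ∀ x, (∀ y, B.tmul C x y = 0) → x = 0 := by
  have key : ∀ x, B.tmul C x = TensorProduct.dualDistribEquiv F V W
      (TensorProduct.congr (B.toDual hB) (C.toDual hC) x) := by
    intro x
    have : (B.tmul C : (V ⊗[F] W) →ₗ[F] Module.Dual F (V ⊗[F] W)) =
        (TensorProduct.dualDistribEquiv F V W).toLinearMap ∘ₗ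
          (TensorProduct.congr (B.toDual hB) (C.toDual hC)).toLinearMap := by
      ext v w v' w'
      simp [TensorProduct.dualDistribEquivOfBasis, LinearMap.BilinForm.toDual_def, mul_comm]
    exact LinearMap.congr_fun this x
  intro x hx
  have h0 : B.tmul C x = 0 := LinearMap.ext hx
  rw [key] at h0
  simpa only [LinearEquiv.map_eq_zero_iff] using h0

/-- For a bilinear form `A` (not necessarily symmetric) representing the quadratic form `q`,
that is `A w w = q w`, the form `B ⊗ q` is `z ↦ (B ⊗ A) (z, z)`. For symmetric `B` it does not
depend on `A`: it is the only quadratic form on `V ⊗ W` with `(B ⊗ q) (v ⊗ w) = B (v, v) q (w)`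
and with polar form `B ⊗ b_q`, see `bilinTensorQuad_tmul`, `polar_bilinTensorQuad` and
`quad_tensor_ext`. -/
def bilinTensorQuad (B : BilinForm F V) (q : QuadraticForm F W) : QuadraticForm F (V ⊗[F] W) :=
  LinearMap.BilinMap.toQuadraticMap
    (B.tmul (LinearMap.BilinMap.toQuadraticMap_surjective q).choose)

theorem bilinTensorQuad_tmul (B : BilinForm F V) (q : QuadraticForm F W) (v : V) (w : W) :
    bilinTensorQuad B q (v ⊗ₜ w) = B v v * q w := by
  have h := (LinearMap.BilinMap.toQuadraticMap_surjective q).choose_spec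
  rw [bilinTensorQuad, LinearMap.BilinMap.toQuadraticMap_apply, tmul_apply]
  conv_rhs => rw [← h]
  rfl

theorem polar_bilinTensorQuad {B : BilinForm F V} (hB : ∀ x y, B x y = B y x)
    (q : QuadraticForm F W) :
    (bilinTensorQuad B q).polarBilin = B.tmul q.polarBilin := by
  have h := (LinearMap.BilinMap.toQuadraticMap_surjective q).choose_spec
  have h2 : q.polarBilin = (LinearMap.BilinMap.toQuadraticMap_surjective q).choose +
      (LinearMap.BilinMap.toQuadraticMap_surjective q).choose.flip := by
    conv_lhs => rw [← h]
    exact LinearMap.BilinMap.polarBilin_toQuadraticMap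
  rw [bilinTensorQuad, LinearMap.BilinMap.polarBilin_toQuadraticMap, h2]
  ext v w v' w'
  simp [hB v' v, add_mul]

theorem quad_tensor_ext {q q' : QuadraticForm F (V ⊗[F] W)}
    (h : ∀ v w, q (v ⊗ₜ w) = q' (v ⊗ₜ w)) (hp : q.polarBilin = q'.polarBilin) : q = q' := by
  ext z
  induction z with
  | zero => simp
  | tmul v w => exact h v w
  | add x y hx hy =>
    have := LinearMap.congr_fun₂ hp x y
    simp only [QuadraticMap.polarBilin_apply_apply, QuadraticMap.polar, hx, hy] at this
    linear_combination this

/-- A nonsingular quadratic form with a totally singular subspace of half the dimension is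
hyperbolic. -/
theorem hyperbolic_of_lagrangian [FiniteDimensional F V] (q : QuadraticForm F V)
    (hq : q.polarBilin.Nondegenerate) (U : Submodule F V) (hU : ∀ x ∈ U, q x = 0)
    (hd : Module.finrank F V = 2 * Module.finrank F U) :
    ∃ n : ℕ, q.Equivalent (QuadraticForm.dualProd F (Fin n → F)) := by
  obtain ⟨C, hC⟩ := U.exists_isCompl
  obtain ⟨A, hA⟩ := LinearMap.BilinMap.toQuadraticMap_surjective (q.restrict C)
  have hb : ∀ x ∈ U, ∀ y ∈ U, q.polarBilin x y = 0 := fun x hx y hy => by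
    simp [QuadraticMap.polar, hU x hx, hU y hy, hU _ (U.add_mem hx hy)]
  -- the map `U → C*` induced by the polar form
  let β : U →ₗ[F] Module.Dual F C :=
    (LinearMap.lcomp F F C.subtype) ∘ₗ q.polarBilin ∘ₗ U.subtype
  have hβ : ∀ (u : U) (c : C), β u c = q.polarBilin u c := fun _ _ => rfl
  have hβi : Function.Injective β := by
    rw [injective_iff_map_eq_zero]
    intro u hu
    have : (u : V) = 0 := by
      refine hq.1 _ fun y => ?_
      obtain ⟨a, ha, c, hc, rfl⟩ := Submodule.mem_sup.1 (hC.sup_eq_top ▸ Submodule.mem_top : y ∈ U ⊔ C)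
      rw [map_add, hb _ u.2 _ ha, zero_add]
      exact LinearMap.congr_fun hu ⟨c, hc⟩
    exact_mod_cast this
  have hfr : Module.finrank F U = Module.finrank F (Module.Dual F C) := by
    have := Submodule.finrank_add_eq_of_isCompl hC
    rw [Subspace.dual_finrank_eq]; omega
  let βe : U ≃ₗ[F] Module.Dual F C := LinearEquiv.ofInjectiveOfFinrankEq β hβi hfr
  let γ : (U × C) ≃ₗ[F] (Module.Dual F C × C) :=
    LinearEquiv.ofBijective
      ((β.coprod A).prod (LinearMap.snd F U C)) (by
        constructor
        · rw [injective_iff_map_eq_zero]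
          rintro ⟨u, c⟩ h
          obtain ⟨h1, h2⟩ := Prod.mk_inj.1 h
          simp only [LinearMap.snd_apply] at h2
          subst h2
          simp only [LinearMap.coprod_apply, map_zero, add_zero] at h1
          rw [hβi (h1.trans (map_zero β).symm)]; rfl
        · rintro ⟨f, c⟩
          obtain ⟨u, hu⟩ := βe.surjective (f - A c)
          have hu' : β u = f - A c := hu
          exact ⟨(u, c), by simp [hu']⟩)
  have hγ : ∀ u c, γ (u, c) = (β u + A c, c) := fun _ _ => rfl
  let e := (Submodule.prodEquivOfIsCompl U C hC).symm ≪≫ₗ γ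
  refine ⟨Module.finrank F C, ?_⟩
  refine QuadraticMap.Equivalent.trans (Q₂ := QuadraticForm.dualProd F C) ⟨⟨e, ?_⟩⟩
    ⟨QuadraticForm.dualProdIsometry (Module.finBasis F C).equivFun⟩
  intro m
  obtain ⟨⟨u, c⟩, rfl⟩ := (Submodule.prodEquivOfIsCompl U C hC).surjective m
  have hAc : A c c = q c := by
    have := QuadraticMap.congr_fun hA c
    simpa using this
  have : e (Submodule.prodEquivOfIsCompl U C hC (u, c)) = γ (u, c) := by simp [e]
  change QuadraticForm.dualProd F C (e _) = _
  rw [this, hγ]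
  simp only [QuadraticForm.dualProd_apply, LinearMap.add_apply, hβ, hAc,
    Submodule.coe_prodEquivOfIsCompl']
  simp [QuadraticMap.polar, hU _ u.2]

theorem dualProd_polar_nondegenerate [FiniteDimensional F V] :
    (QuadraticForm.dualProd F V).polarBilin.Nondegenerate := by
  have hp : ∀ x y : Module.Dual F V × V,
      (QuadraticForm.dualProd F V).polarBilin x y = x.1 y.2 + y.1 x.2 := fun x y => by
    simp [QuadraticMap.polar]
    ring
  refine nondeg_of_symm (fun x y => by rw [hp, hp, add_comm]) fun x hx => ?_
  refine Prod.ext (LinearMap.ext fun v => ?_) ?_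
  · simpa [hp] using hx (0, v)
  · refine (Module.forall_dual_apply_eq_zero_iff F x.2).1 fun f => ?_
    simpa [hp] using hx (f, 0)

end Forms

/-! ### The Witt ring of nondegenerate symmetric bilinear forms -/

section BilinIsometries

variable {F : Type*} [Field F]
variable {V : Type*} [AddCommGroup V] [Module F V]
variable {W : Type*} [AddCommGroup W] [Module F W]
variable {V' : Type*} [AddCommGroup V'] [Module F V']
variable {W' : Type*} [AddCommGroup W'] [Module F W']

theorem bilinSum_congr {B : BilinForm F V} {B' : BilinForm F V'} {C : BilinForm F W}
    {C' : BilinForm F W'} (h : B.Equivalent B') (k : C.Equivalent C') :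
    (bilinSum B C).Equivalent (bilinSum B' C') := by
  obtain ⟨e⟩ := h
  obtain ⟨f⟩ := k
  exact ⟨⟨e.toLinearEquiv.prodCongr f.toLinearEquiv, fun x y =>
    congr_arg₂ (· + ·) (e.map_app' x.1 y.1) (f.map_app' x.2 y.2)⟩⟩

theorem bilinSum_comm (B : BilinForm F V) (C : BilinForm F W) :
    (bilinSum B C).Equivalent (bilinSum C B) :=
  ⟨⟨LinearEquiv.prodComm F V W, fun _ _ => add_comm _ _⟩⟩

theorem bilinSum_assoc (B : BilinForm F V) (C : BilinForm F W) (D : BilinForm F V') :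
    (bilinSum (bilinSum B C) D).Equivalent (bilinSum B (bilinSum C D)) :=
  ⟨⟨LinearEquiv.prodAssoc F V W V', fun _ _ => (add_assoc _ _ _).symm⟩⟩

theorem bilinSum_right_comm (B : BilinForm F V) (C : BilinForm F W) (D : BilinForm F V') :
    (bilinSum (bilinSum B C) D).Equivalent (bilinSum (bilinSum B D) C) :=
  (bilinSum_assoc B C D).trans
    ((bilinSum_congr (.refl B) (bilinSum_comm C D)).trans (bilinSum_assoc B D C).symm)

theorem bilinTensor_congr {B : BilinForm F V} {B' : BilinForm F V'} {C : BilinForm F W}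
    {C' : BilinForm F W'} (h : B.Equivalent B') (k : C.Equivalent C') :
    LinearMap.BilinForm.Equivalent (B.tmul C) (B'.tmul C') := by
  obtain ⟨e⟩ := h
  obtain ⟨f⟩ := k
  refine ⟨⟨TensorProduct.congr e.toLinearEquiv f.toLinearEquiv, fun x y => ?_⟩⟩
  have : (B'.tmul C').compl₁₂
      (TensorProduct.congr e.toLinearEquiv f.toLinearEquiv).toLinearMap
      (TensorProduct.congr e.toLinearEquiv f.toLinearEquiv).toLinearMap = B.tmul C := by
    ext v w v' w'
    exact congr_arg₂ (· * ·) (f.map_app' w w') (e.map_app' v v')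
  exact LinearMap.congr_fun₂ this x y

theorem bilinTensor_comm (B : BilinForm F V) (C : BilinForm F W) :
    LinearMap.BilinForm.Equivalent (B.tmul C) (C.tmul B) := by
  refine ⟨⟨TensorProduct.comm F V W, fun x y => ?_⟩⟩
  have : (C.tmul B).compl₁₂ (TensorProduct.comm F V W).toLinearMap
      (TensorProduct.comm F V W).toLinearMap = B.tmul C := by
    ext v w v' w'
    exact mul_comm _ _
  exact LinearMap.congr_fun₂ this x y

theorem bilinTensor_assoc (B : BilinForm F V) (C : BilinForm F W) (D : BilinForm F V') :
    LinearMap.BilinForm.Equivalent (BilinForm.tmul (B.tmul C) D) (B.tmul (C.tmul D)) := by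
  refine ⟨⟨TensorProduct.assoc F V W V', fun x y => ?_⟩⟩
  have : (B.tmul (C.tmul D)).compl₁₂ (TensorProduct.assoc F V W V').toLinearMap
      (TensorProduct.assoc F V W V').toLinearMap = BilinForm.tmul (B.tmul C) D := by
    ext v w x v' w' x'
    simp [mul_assoc]
  exact LinearMap.congr_fun₂ this x y

theorem bilinTensor_one (B : BilinForm F V) :
    LinearMap.BilinForm.Equivalent (BilinForm.tmul (LinearMap.mul F F) B) B := by
  refine ⟨⟨TensorProduct.lid F V, fun x y => ?_⟩⟩
  have : B.compl₁₂ (TensorProduct.lid F V).toLinearMap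
      (TensorProduct.lid F V).toLinearMap = BilinForm.tmul (LinearMap.mul F F) B := by
    ext v v'
    simp
  exact LinearMap.congr_fun₂ this x y

theorem bilinTensor_sum (B : BilinForm F V) (C : BilinForm F W) (D : BilinForm F W') :
    LinearMap.BilinForm.Equivalent (B.tmul (bilinSum C D))
      (bilinSum (B.tmul C) (B.tmul D)) := by
  refine ⟨⟨TensorProduct.prodRight F F V W W', fun x y => ?_⟩⟩
  have : (bilinSum (B.tmul C) (B.tmul D)).compl₁₂
      (TensorProduct.prodRight F F V W W').toLinearMap
      (TensorProduct.prodRight F F V W W').toLinearMap = B.tmul (bilinSum C D) := by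
    ext v w v' w' <;> simp
  exact LinearMap.congr_fun₂ this x y

/-- A bilinear form is metabolic if it has a Lagrangian: a totally isotropic subspace of half
the dimension of the whole space. -/
def IsMetabolic (B : BilinForm F V) : Prop :=
  ∃ U : Submodule F V, (∀ x ∈ U, ∀ y ∈ U, B x y = 0) ∧
    Module.finrank F V = 2 * Module.finrank F U

theorem finrank_submodule_prod [FiniteDimensional F V] [FiniteDimensional F W]
    (U : Submodule F V) (U' : Submodule F W) :
    Module.finrank F (U.prod U') = Module.finrank F U + Module.finrank F U' := by
  have h : U.prod U' = LinearMap.range (U.subtype.prodMap U'.subtype) := by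
    rw [LinearMap.range_prodMap, Submodule.range_subtype, Submodule.range_subtype]
  rw [h, LinearMap.finrank_range_of_inj, Module.finrank_prod]
  exact U.injective_subtype.prodMap U'.injective_subtype

theorem IsMetabolic.sum [FiniteDimensional F V] [FiniteDimensional F W]
    {B : BilinForm F V} {C : BilinForm F W}
    (hB : IsMetabolic B) (hC : IsMetabolic C) : IsMetabolic (bilinSum B C) := by
  obtain ⟨U, hU, hd⟩ := hB
  obtain ⟨U', hU', hd'⟩ := hC
  refine ⟨U.prod U', fun x hx y hy => ?_, ?_⟩
  · rw [bilinSum_apply, hU _ hx.1 _ hy.1, hU' _ hx.2 _ hy.2, add_zero]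
  · rw [Module.finrank_prod, finrank_submodule_prod]; omega

theorem finrank_range_lTensor (U : Submodule F V) :
    Module.finrank F (LinearMap.range (TensorProduct.map U.subtype (LinearMap.id : W →ₗ[F] W))) =
      Module.finrank F U * Module.finrank F W := by
  rw [LinearMap.finrank_range_of_inj, Module.finrank_tensorProduct]
  exact Module.Flat.rTensor_preserves_injective_linearMap (M := W) U.subtype U.injective_subtype

theorem IsMetabolic.tensor {B : BilinForm F V} (hB : IsMetabolic B) (C : BilinForm F W) :
    IsMetabolic (B.tmul C : BilinForm F (V ⊗[F] W)) := by
  obtain ⟨U, hU, hd⟩ := hB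
  refine ⟨LinearMap.range (TensorProduct.map U.subtype (LinearMap.id : W →ₗ[F] W)), ?_, ?_⟩
  · rintro _ ⟨x, rfl⟩ _ ⟨y, rfl⟩
    have : (B.tmul C).compl₁₂ (TensorProduct.map U.subtype (LinearMap.id : W →ₗ[F] W))
        (TensorProduct.map U.subtype (LinearMap.id : W →ₗ[F] W)) = 0 := by
      ext v w v' w'
      simp [hU _ v.2 _ v'.2]
    exact LinearMap.congr_fun₂ this x y
  · rw [finrank_range_lTensor, Module.finrank_tensorProduct, hd, mul_assoc]

theorem IsMetabolic.neg_self (B : BilinForm F V) [FiniteDimensional F V] :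
    IsMetabolic (bilinSum (-B) B) := by
  refine ⟨LinearMap.range ((LinearMap.id : V →ₗ[F] V).prod LinearMap.id), ?_, ?_⟩
  · rintro _ ⟨x, rfl⟩ _ ⟨y, rfl⟩
    simp
  · rw [LinearMap.finrank_range_of_inj, Module.finrank_prod, two_mul]
    exact fun x y h => congr_arg Prod.fst h

end BilinIsometries

/-- A finite-dimensional space with a nondegenerate symmetric bilinear form. -/
structure BilinSpace (F : Type u) [Field F] : Type (u + 1) where
  carrier : Type u
  [addCommGroup : AddCommGroup carrier]
  [module : Module F carrier]
  [finite : FiniteDimensional F carrier]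
  form : BilinForm F carrier
  symm : ∀ x y, form x y = form y x
  nondegenerate : form.Nondegenerate

attribute [instance] BilinSpace.addCommGroup BilinSpace.module BilinSpace.finite

namespace BilinSpace

variable {F : Type u} [Field F]

/-- Orthogonal sum. -/
def sum (X Y : BilinSpace F) : BilinSpace F where
  carrier := X.carrier × Y.carrier
  form := bilinSum X.form Y.form
  symm x y := by simp [X.symm x.1, Y.symm x.2]
  nondegenerate := bilinSum_nondegenerate X.nondegenerate Y.nondegenerate

/-- Tensor product. -/
def tensor (X Y : BilinSpace F) : BilinSpace F where
  carrier := X.carrier ⊗[F] Y.carrier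
  form := X.form.tmul Y.form
  symm := (LinearMap.IsSymm.tmul ⟨X.symm⟩ ⟨Y.symm⟩).eq
  nondegenerate := nondeg_of_symm (LinearMap.IsSymm.tmul ⟨X.symm⟩ ⟨Y.symm⟩).eq
    (tmul_separatingLeft X.nondegenerate Y.nondegenerate)

/-- The space with the opposite form. -/
def neg (X : BilinSpace F) : BilinSpace F where
  carrier := X.carrier
  form := -X.form
  symm x y := by simp [X.symm x]
  nondegenerate := nondeg_of_symm (fun x y => by simp [X.symm x])
    fun x hx => X.nondegenerate.1 x fun y => by simpa using hx y

variable (F) in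
/-- The zero space. -/
def zero : BilinSpace F where
  carrier := PUnit
  form := 0
  symm _ _ := rfl
  nondegenerate := nondeg_of_symm (fun _ _ => rfl) fun _ _ => rfl

variable (F) in
/-- The form `⟨1⟩`. -/
def one : BilinSpace F where
  carrier := F
  form := LinearMap.mul F F
  symm := mul_comm
  nondegenerate := nondeg_of_symm mul_comm fun x hx => by simpa using hx 1

/-- Witt equivalence: isometry after adding metabolic forms. -/
def WittEquiv (X Y : BilinSpace F) : Prop :=
  ∃ M N : BilinSpace F, IsMetabolic M.form ∧ IsMetabolic N.form ∧
    (X.sum M).form.Equivalent (Y.sum N).form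

theorem zero_metabolic : IsMetabolic (zero F).form :=
  ⟨⊥, fun _ _ _ _ => rfl, by
    change Module.finrank F PUnit.{u + 1} = _
    rw [Module.finrank_zero_of_subsingleton, finrank_bot]⟩

theorem WittEquiv.of_isometry {X Y : BilinSpace F} (h : X.form.Equivalent Y.form) :
    WittEquiv X Y :=
  ⟨zero F, zero F, zero_metabolic, zero_metabolic, bilinSum_congr h (.refl _)⟩

theorem WittEquiv.symm {X Y : BilinSpace F} (h : WittEquiv X Y) : WittEquiv Y X := by
  obtain ⟨M, N, hM, hN, e⟩ := h
  exact ⟨N, M, hN, hM, e.symm⟩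

theorem WittEquiv.trans {X Y Z : BilinSpace F} (h : WittEquiv X Y) (k : WittEquiv Y Z) :
    WittEquiv X Z := by
  obtain ⟨M, N, hM, hN, e⟩ := h
  obtain ⟨K, L, hK, hL, f⟩ := k
  refine ⟨M.sum K, L.sum N, hM.sum hK, hL.sum hN, ?_⟩
  exact (bilinSum_assoc _ _ _).symm.trans <| (bilinSum_congr e (.refl _)).trans <|
    (bilinSum_right_comm _ _ _).trans <| (bilinSum_congr f (.refl _)).trans <|
    bilinSum_assoc _ _ _

theorem WittEquiv.of_metabolic {X : BilinSpace F} (h : IsMetabolic X.form) :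
    WittEquiv X (zero F) :=
  ⟨zero F, X, zero_metabolic, h, bilinSum_comm _ _⟩

theorem WittEquiv.sum_left {X X' : BilinSpace F} (h : WittEquiv X X') (Y : BilinSpace F) :
    WittEquiv (X.sum Y) (X'.sum Y) := by
  obtain ⟨M, N, hM, hN, e⟩ := h
  exact ⟨M, N, hM, hN, (bilinSum_right_comm _ _ _).trans <|
    (bilinSum_congr e (.refl _)).trans (bilinSum_right_comm _ _ _)⟩

theorem WittEquiv.sum_comm (X Y : BilinSpace F) : WittEquiv (X.sum Y) (Y.sum X) :=
  .of_isometry (bilinSum_comm _ _)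

theorem WittEquiv.sum {X X' Y Y' : BilinSpace F} (h : WittEquiv X X') (k : WittEquiv Y Y') :
    WittEquiv (X.sum Y) (X'.sum Y') :=
  (h.sum_left Y).trans <| (WittEquiv.sum_comm _ _).trans <|
    (k.sum_left X').trans (WittEquiv.sum_comm _ _)

theorem WittEquiv.tensor_comm (X Y : BilinSpace F) : WittEquiv (X.tensor Y) (Y.tensor X) :=
  .of_isometry (bilinTensor_comm _ _)

theorem WittEquiv.tensor_right (X : BilinSpace F) {Y Y' : BilinSpace F} (h : WittEquiv Y Y') :
    WittEquiv (X.tensor Y) (X.tensor Y') := by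
  obtain ⟨M, N, hM, hN, e⟩ := h
  have key : ∀ Z K : BilinSpace F, LinearMap.BilinForm.Equivalent
      (X.tensor (Z.sum K)).form ((X.tensor Z).sum (K.tensor X)).form := fun Z K =>
    (bilinTensor_sum _ _ _).trans (bilinSum_congr (.refl _) (bilinTensor_comm _ _))
  exact ⟨M.tensor X, N.tensor X, hM.tensor _, hN.tensor _,
    (key Y M).symm.trans ((bilinTensor_congr (.refl _) e).trans (key Y' N))⟩

theorem WittEquiv.tensor {X X' Y Y' : BilinSpace F} (h : WittEquiv X X') (k : WittEquiv Y Y') :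
    WittEquiv (X.tensor Y) (X'.tensor Y') :=
  (k.tensor_right X).trans <| (WittEquiv.tensor_comm _ _).trans <|
    (h.tensor_right Y').trans (WittEquiv.tensor_comm _ _)

theorem WittEquiv.neg {X Y : BilinSpace F} (h : WittEquiv X Y) : WittEquiv X.neg Y.neg := by
  obtain ⟨M, N, ⟨U, hU, hd⟩, ⟨U', hU', hd'⟩, ⟨e⟩⟩ := h
  refine ⟨M.neg, N.neg, ⟨U, fun x hx y hy => ?_, hd⟩, ⟨U', fun x hx y hy => ?_, hd'⟩,
    ⟨e.toLinearEquiv, fun x y => ?_⟩⟩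
  · exact neg_eq_zero.2 (hU x hx y hy)
  · exact neg_eq_zero.2 (hU' x hx y hy)
  · exact (neg_add _ _).symm.trans ((congr_arg Neg.neg (e.map_app' x y)).trans (neg_add _ _))

variable (F) in
/-- Witt equivalence as a setoid. -/
def setoid : Setoid (BilinSpace F) :=
  ⟨WittEquiv, fun _ => .of_isometry (.refl _), .symm, .trans⟩

end BilinSpace

/-- The Witt ring `W(F)` of nondegenerate symmetric bilinear forms. -/
def WittRing (F : Type u) [Field F] : Type (u + 1) := Quotient (BilinSpace.setoid F)

namespace WittRing

variable {F : Type u} [Field F]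

/-- The Witt class of a nondegenerate symmetric bilinear form. -/
def mk (X : BilinSpace F) : WittRing F := Quotient.mk (BilinSpace.setoid F) X

theorem mk_eq {X Y : BilinSpace F} : mk X = mk Y ↔ X.WittEquiv Y :=
  Quotient.eq (r := BilinSpace.setoid F)

theorem mk_eq_of_isometry {X Y : BilinSpace F} (h : X.form.Equivalent Y.form) : mk X = mk Y :=
  mk_eq.2 (.of_isometry h)

theorem ind {P : WittRing F → Prop} (h : ∀ X, P (mk X)) (w : WittRing F) : P w :=
  Quotient.inductionOn w h

instance : Zero (WittRing F) := ⟨mk (.zero F)⟩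
instance : One (WittRing F) := ⟨mk (.one F)⟩
instance : Add (WittRing F) :=
  ⟨Quotient.map₂ BilinSpace.sum fun _ _ h _ _ k => BilinSpace.WittEquiv.sum h k⟩
instance : Mul (WittRing F) :=
  ⟨Quotient.map₂ BilinSpace.tensor fun _ _ h _ _ k => BilinSpace.WittEquiv.tensor h k⟩
instance : Neg (WittRing F) :=
  ⟨Quotient.map BilinSpace.neg fun _ _ h => BilinSpace.WittEquiv.neg h⟩

theorem zero_def : (0 : WittRing F) = mk (.zero F) := rfl
theorem one_def : (1 : WittRing F) = mk (.one F) := rfl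
theorem mk_add (X Y : BilinSpace F) : mk X + mk Y = mk (X.sum Y) := rfl
theorem mk_mul (X Y : BilinSpace F) : mk X * mk Y = mk (X.tensor Y) := rfl
theorem mk_neg (X : BilinSpace F) : -mk X = mk X.neg := rfl

protected theorem add_comm' (a b : WittRing F) : a + b = b + a := by
  induction a using ind with | _ X
  induction b using ind with | _ Y
  exact mk_eq_of_isometry (bilinSum_comm _ _)

protected theorem zero_add' (a : WittRing F) : 0 + a = a := by
  induction a using ind with | _ X
  refine mk_eq_of_isometry ⟨⟨LinearEquiv.uniqueProd (M₂ := PUnit.{u + 1}), fun x y => ?_⟩⟩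
  exact (zero_add _).symm

protected theorem mul_comm' (a b : WittRing F) : a * b = b * a := by
  induction a using ind with | _ X
  induction b using ind with | _ Y
  exact mk_eq_of_isometry (bilinTensor_comm _ _)

protected theorem one_mul' (a : WittRing F) : 1 * a = a := by
  induction a using ind with | _ X
  exact mk_eq_of_isometry (bilinTensor_one _)

protected theorem mul_add' (a b c : WittRing F) : a * (b + c) = a * b + a * c := by
  induction a using ind with | _ X
  induction b using ind with | _ Y
  induction c using ind with | _ Z
  exact mk_eq_of_isometry (bilinTensor_sum _ _ _)

protected theorem zero_mul' (a : WittRing F) : 0 * a = 0 := by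
  induction a using ind with | _ X
  exact mk_eq.2 (.of_metabolic (BilinSpace.zero_metabolic.tensor _))

instance : CommRing (WittRing F) where
  add_assoc a b c := by
    induction a using ind with | _ X
    induction b using ind with | _ Y
    induction c using ind with | _ Z
    exact mk_eq_of_isometry (bilinSum_assoc _ _ _)
  zero_add := WittRing.zero_add'
  add_zero a := by rw [WittRing.add_comm', WittRing.zero_add']
  add_comm := WittRing.add_comm'
  nsmul := nsmulRec
  zsmul := zsmulRec
  neg_add_cancel a := by
    induction a using ind with | _ X
    exact mk_eq.2 (.of_metabolic (.neg_self _))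
  mul_assoc a b c := by
    induction a using ind with | _ X
    induction b using ind with | _ Y
    induction c using ind with | _ Z
    exact mk_eq_of_isometry (bilinTensor_assoc _ _ _)
  one_mul := WittRing.one_mul'
  mul_one a := by rw [WittRing.mul_comm', WittRing.one_mul']
  mul_comm := WittRing.mul_comm'
  left_distrib := WittRing.mul_add'
  right_distrib a b c := by
    rw [WittRing.mul_comm', WittRing.mul_add', WittRing.mul_comm' c, WittRing.mul_comm' c]
  zero_mul := WittRing.zero_mul'
  mul_zero a := by rw [WittRing.mul_comm', WittRing.zero_mul']

theorem dim_mod_two_eq {X Y : BilinSpace F} (h : X.WittEquiv Y) :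
    (Module.finrank F X.carrier : ZMod 2) = (Module.finrank F Y.carrier : ZMod 2) := by
  obtain ⟨M, N, ⟨U, _, hd⟩, ⟨U', _, hd'⟩, ⟨e⟩⟩ := h
  have h1 : Module.finrank F (X.carrier × M.carrier) = Module.finrank F (Y.carrier × N.carrier) :=
    e.toLinearEquiv.finrank_eq
  rw [Module.finrank_prod, Module.finrank_prod, hd, hd'] at h1
  rw [ZMod.natCast_eq_natCast_iff']
  omega

variable (F) in
/-- The dimension index `W(F) → ℤ/2`, sending the class of a form to its dimension modulo `2`. -/
def dimIndex : WittRing F →+* ZMod 2 where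
  toFun := Quotient.lift (fun X : BilinSpace F => (Module.finrank F X.carrier : ZMod 2))
    fun _ _ h => dim_mod_two_eq h
  map_one' := by
    change (Module.finrank F F : ZMod 2) = 1
    simp
  map_zero' := by
    change (Module.finrank F PUnit.{u + 1} : ZMod 2) = 0
    rw [Module.finrank_zero_of_subsingleton, Nat.cast_zero]
  map_add' a b := by
    induction a using ind with | _ X
    induction b using ind with | _ Y
    change (Module.finrank F (X.carrier × Y.carrier) : ZMod 2) =
      Module.finrank F X.carrier + Module.finrank F Y.carrier
    simp
  map_mul' a b := by
    induction a using ind with | _ X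
    induction b using ind with | _ Y
    change (Module.finrank F (X.carrier ⊗[F] Y.carrier) : ZMod 2) =
      Module.finrank F X.carrier * Module.finrank F Y.carrier
    simp

theorem dimIndex_mk (X : BilinSpace F) : dimIndex F (mk X) = Module.finrank F X.carrier := rfl

variable (F) in
/-- The fundamental ideal `I(F)`: the classes of even-dimensional forms. -/
def fundamentalIdeal : Ideal (WittRing F) := RingHom.ker (dimIndex F)

end WittRing

/-! ### The Witt group of nonsingular quadratic forms -/

section QuadIsometries

variable {F : Type*} [Field F]
variable {V : Type*} [AddCommGroup V] [Module F V]
variable {W : Type*} [AddCommGroup W] [Module F W]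
variable {V' : Type*} [AddCommGroup V'] [Module F V']
variable {W' : Type*} [AddCommGroup W'] [Module F W']

theorem quadProd_comm (p : QuadraticForm F V) (q : QuadraticForm F W) :
    QuadraticMap.Equivalent (p.prod q) (q.prod p) :=
  ⟨QuadraticMap.IsometryEquiv.prodComm p q⟩

theorem quadProd_assoc (p : QuadraticForm F V) (q : QuadraticForm F W)
    (r : QuadraticForm F V') :
    QuadraticMap.Equivalent ((p.prod q).prod r) (p.prod (q.prod r)) :=
  ⟨⟨LinearEquiv.prodAssoc F V W V', fun _ => (add_assoc _ _ _).symm⟩⟩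

theorem quadProd_right_comm (p : QuadraticForm F V) (q : QuadraticForm F W)
    (r : QuadraticForm F V') :
    QuadraticMap.Equivalent ((p.prod q).prod r) ((p.prod r).prod q) :=
  (quadProd_assoc p q r).trans <|
    (QuadraticMap.Equivalent.prod (.refl p) (quadProd_comm q r)).trans (quadProd_assoc p r q).symm

theorem polarBilin_quadProd (p : QuadraticForm F V) (q : QuadraticForm F W) :
    QuadraticMap.polarBilin (p.prod q) = bilinSum p.polarBilin q.polarBilin := by
  refine LinearMap.ext₂ fun x y => ?_
  simp

theorem polarBilin_symm (q : QuadraticForm F V) (x y : V) :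
    q.polarBilin x y = q.polarBilin y x := by
  simp [QuadraticMap.polar_comm q x y]

theorem equivalent_of_tensor {B : BilinForm F V} (hB : ∀ x y, B x y = B y x)
    {q : QuadraticForm F W} {r : QuadraticForm F V'} (e : (V ⊗[F] W) ≃ₗ[F] V')
    (h1 : ∀ v w, r (e (v ⊗ₜ w)) = B v v * q w)
    (h2 : ∀ v w v' w', r.polarBilin (e (v ⊗ₜ w)) (e (v' ⊗ₜ w')) = B v v' * q.polarBilin w w') :
    (bilinTensorQuad B q).Equivalent r := by
  have : r.comp e.toLinearMap = bilinTensorQuad B q := by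
    refine quad_tensor_ext (fun v w => ?_) ?_
    · rw [bilinTensorQuad_tmul]; exact h1 v w
    · rw [polar_bilinTensorQuad hB, QuadraticMap.polarBilin_comp]
      ext v w v' w'
      have := h2 v w v' w'
      simp only [QuadraticMap.polarBilin_apply_apply] at this
      simp [this, mul_comm]
  exact ⟨⟨e, fun x => QuadraticMap.congr_fun this x⟩⟩

theorem polar_eq_of_isometry {q : QuadraticForm F V} {q' : QuadraticForm F V'}
    (e : q.IsometryEquiv q') (x y : V) : q'.polarBilin (e x) (e y) = q.polarBilin x y := by
  simp [QuadraticMap.polar, ← map_add]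

theorem polar_tensor_apply {B : BilinForm F V} (hB : ∀ x y, B x y = B y x)
    (q : QuadraticForm F W) (v v' : V) (w w' : W) :
    (bilinTensorQuad B q).polarBilin (v ⊗ₜ w) (v' ⊗ₜ w') = B v v' * q.polarBilin w w' := by
  rw [polar_bilinTensorQuad hB, tmul_apply]

theorem bilinTensorQuad_congr {B : BilinForm F V} {B' : BilinForm F V'}
    (hB : ∀ x y, B x y = B y x) (hB' : ∀ x y, B' x y = B' y x)
    {q : QuadraticForm F W} {q' : QuadraticForm F W'} (h : B.Equivalent B')
    (k : q.Equivalent q') :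
    (bilinTensorQuad B q).Equivalent (bilinTensorQuad B' q') := by
  obtain ⟨e⟩ := h
  obtain ⟨f⟩ := k
  refine equivalent_of_tensor hB (TensorProduct.congr e.toLinearEquiv f.toLinearEquiv) ?_ ?_
  · intro v w
    rw [TensorProduct.congr_tmul, bilinTensorQuad_tmul]
    exact congr_arg₂ (· * ·) (e.map_app' v v) (f.map_app' w)
  · intro v w v' w'
    rw [TensorProduct.congr_tmul, TensorProduct.congr_tmul, polar_tensor_apply hB']
    exact congr_arg₂ (· * ·) (e.map_app' v v') (polar_eq_of_isometry f w w')

theorem bilinTensorQuad_one (q : QuadraticForm F W) :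
    (bilinTensorQuad (LinearMap.mul F F) q).Equivalent q := by
  refine equivalent_of_tensor (fun x y => mul_comm x y) (TensorProduct.lid F W) ?_ ?_
  · intro v w
    rw [TensorProduct.lid_tmul, QuadraticMap.map_smul]
    rfl
  · intro v w v' w'
    simp [mul_assoc, mul_left_comm]

theorem bilinTensorQuad_assoc {B : BilinForm F V} {C : BilinForm F V'}
    (hB : ∀ x y, B x y = B y x) (hC : ∀ x y, C x y = C y x) (q : QuadraticForm F W) :
    (bilinTensorQuad (B.tmul C) q).Equivalent (bilinTensorQuad B (bilinTensorQuad C q)) := by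
  let e := TensorProduct.assoc F V V' W
  have : (bilinTensorQuad B (bilinTensorQuad C q)).comp e.toLinearMap =
      bilinTensorQuad (B.tmul C) q := by
    have hp : ((bilinTensorQuad B (bilinTensorQuad C q)).comp e.toLinearMap).polarBilin =
        (bilinTensorQuad (B.tmul C) q).polarBilin := by
      rw [polar_bilinTensorQuad (LinearMap.IsSymm.tmul ⟨hB⟩ ⟨hC⟩).eq,
        QuadraticMap.polarBilin_comp, polar_bilinTensorQuad hB, polar_bilinTensorQuad hC]
      ext v v' w x x' y
      simp [e, mul_assoc]
    refine quad_tensor_ext (fun z w => ?_) hp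
    induction z with
    | zero => simp
    | tmul v v' =>
      simp [e, bilinTensorQuad_tmul, mul_comm, mul_left_comm]
    | add x y hx hy =>
      have h := LinearMap.congr_fun₂ hp (x ⊗ₜ w) (y ⊗ₜ w)
      simp only [QuadraticMap.polarBilin_apply_apply, QuadraticMap.polar, hx, hy] at h
      rw [TensorProduct.add_tmul]
      linear_combination h
  exact ⟨⟨e, fun x => QuadraticMap.congr_fun this x⟩⟩

theorem bilinTensorQuad_prod {B : BilinForm F V} (hB : ∀ x y, B x y = B y x)
    (q : QuadraticForm F W) (r : QuadraticForm F W') :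
    (bilinTensorQuad B (q.prod r)).Equivalent
      ((bilinTensorQuad B q).prod (bilinTensorQuad B r)) := by
  refine equivalent_of_tensor hB (TensorProduct.prodRight F F V W W') ?_ ?_
  · rintro v ⟨w, w'⟩
    simp [bilinTensorQuad_tmul, mul_add]
  · rintro v ⟨w, w'⟩ v' ⟨x, x'⟩
    rw [polarBilin_quadProd, polarBilin_quadProd, bilinSum_apply, bilinSum_apply,
      TensorProduct.prodRight_tmul, TensorProduct.prodRight_tmul, polar_tensor_apply hB,
      polar_tensor_apply hB, mul_add]

theorem bilinSum_tensorQuad {B : BilinForm F V} {C : BilinForm F V'}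
    (hB : ∀ x y, B x y = B y x) (hC : ∀ x y, C x y = C y x) (q : QuadraticForm F W) :
    (bilinTensorQuad (bilinSum B C) q).Equivalent
      ((bilinTensorQuad B q).prod (bilinTensorQuad C q)) := by
  refine equivalent_of_tensor (fun x y => by simp [hB x.1, hC x.2])
    (TensorProduct.prodLeft F F V V' W) ?_ ?_
  · rintro ⟨v, v'⟩ w
    simp [bilinTensorQuad_tmul, add_mul]
  · rintro ⟨v, v'⟩ w ⟨x, x'⟩ y
    rw [polarBilin_quadProd, bilinSum_apply, bilinSum_apply,
      TensorProduct.prodLeft_tmul, TensorProduct.prodLeft_tmul, polar_tensor_apply hB,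
      polar_tensor_apply hC, add_mul]

/-- A quadratic form is hyperbolic if it is isometric to an orthogonal sum of hyperbolic planes,
that is to the form `(f, x) ↦ f x` on `(Fⁿ)* × Fⁿ` for some `n`. -/
def IsHyperbolic (q : QuadraticForm F V) : Prop :=
  ∃ n : ℕ, q.Equivalent (QuadraticForm.dualProd F (Fin n → F))

theorem IsHyperbolic.exists_lagrangian {q : QuadraticForm F V} (h : IsHyperbolic q) :
    ∃ U : Submodule F V, (∀ x ∈ U, q x = 0) ∧
      Module.finrank F V = 2 * Module.finrank F U := by
  obtain ⟨n, ⟨e⟩⟩ := h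
  refine ⟨LinearMap.range (e.toLinearEquiv.symm.toLinearMap ∘ₗ
    LinearMap.inl F (Module.Dual F (Fin n → F)) (Fin n → F)), ?_, ?_⟩
  · rintro _ ⟨f, rfl⟩
    have := e.symm.map_app (f, 0)
    exact this.trans (map_zero f)
  · rw [LinearMap.finrank_range_of_inj, e.toLinearEquiv.finrank_eq, Module.finrank_prod,
      Subspace.dual_finrank_eq, two_mul]
    exact e.toLinearEquiv.symm.injective.comp LinearMap.inl_injective

theorem IsHyperbolic.prod {p : QuadraticForm F V} {q : QuadraticForm F W}
    (hp : IsHyperbolic p) (hq : IsHyperbolic q) : IsHyperbolic (p.prod q) := by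
  obtain ⟨m, hm⟩ := hp
  obtain ⟨n, hn⟩ := hq
  refine ⟨m + n, (QuadraticMap.Equivalent.prod hm hn).trans ?_⟩
  refine QuadraticMap.Equivalent.trans ⟨QuadraticForm.dualProdProdIsometry.symm⟩
    ⟨QuadraticForm.dualProdIsometry (LinearEquiv.ofFinrankEq _ _ ?_)⟩
  simp

end QuadIsometries

/-- A finite-dimensional space with a nonsingular quadratic form, that is one whose polar form is
nondegenerate. Over a field of characteristic `2` these are the forms isometric to
`[a₁, b₁] ⊥ ⋯ ⊥ [aᵣ, bᵣ]`, where `[a, b]` is `a X² + X Y + b Y²`. -/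
structure QuadSpace (F : Type u) [Field F] : Type (u + 1) where
  carrier : Type u
  [addCommGroup : AddCommGroup carrier]
  [module : Module F carrier]
  [finite : FiniteDimensional F carrier]
  form : QuadraticForm F carrier
  nonsingular : form.polarBilin.Nondegenerate

attribute [instance] QuadSpace.addCommGroup QuadSpace.module QuadSpace.finite

namespace QuadSpace

variable {F : Type u} [Field F]

theorem isHyperbolic_of_lagrangian (X : QuadSpace F) (U : Submodule F X.carrier)
    (hU : ∀ x ∈ U, X.form x = 0)
    (hd : Module.finrank F X.carrier = 2 * Module.finrank F U) : IsHyperbolic X.form :=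
  hyperbolic_of_lagrangian X.form X.nonsingular U hU hd

/-- Orthogonal sum. -/
def sum (X Y : QuadSpace F) : QuadSpace F where
  carrier := X.carrier × Y.carrier
  form := X.form.prod Y.form
  nonsingular := by
    rw [polarBilin_quadProd]
    exact bilinSum_nondegenerate X.nonsingular Y.nonsingular

/-- The space with the opposite form. -/
def neg (X : QuadSpace F) : QuadSpace F where
  carrier := X.carrier
  form := -X.form
  nonsingular := nondeg_of_symm (polarBilin_symm _) fun x hx => X.nonsingular.1 x fun y => by
    have := hx y
    simpa [QuadraticMap.polar_neg] using this

variable (F) in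
/-- The zero space. -/
def zero : QuadSpace F where
  carrier := PUnit
  form := 0
  nonsingular := nondeg_of_symm (polarBilin_symm _) fun _ _ => rfl

/-- The tensor product of a symmetric bilinear form and a quadratic form. -/
def tensor (B : BilinSpace F) (X : QuadSpace F) : QuadSpace F where
  carrier := B.carrier ⊗[F] X.carrier
  form := bilinTensorQuad B.form X.form
  nonsingular := nondeg_of_symm (polarBilin_symm _) (by
    rw [polar_bilinTensorQuad B.symm]
    exact tmul_separatingLeft B.nondegenerate X.nonsingular)

/-- Witt equivalence: isometry after adding hyperbolic forms. -/
def WittEquiv (X Y : QuadSpace F) : Prop :=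
  ∃ M N : QuadSpace F, IsHyperbolic M.form ∧ IsHyperbolic N.form ∧
    (X.sum M).form.Equivalent (Y.sum N).form

theorem zero_hyperbolic : IsHyperbolic (zero F).form :=
  (zero F).isHyperbolic_of_lagrangian ⊥ (fun _ _ => rfl) (by
    change Module.finrank F PUnit.{u + 1} = _
    rw [Module.finrank_zero_of_subsingleton, finrank_bot])

theorem WittEquiv.of_isometry {X Y : QuadSpace F} (h : X.form.Equivalent Y.form) :
    WittEquiv X Y :=
  ⟨zero F, zero F, zero_hyperbolic, zero_hyperbolic, QuadraticMap.Equivalent.prod h (.refl _)⟩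

theorem WittEquiv.symm {X Y : QuadSpace F} (h : WittEquiv X Y) : WittEquiv Y X := by
  obtain ⟨M, N, hM, hN, e⟩ := h
  exact ⟨N, M, hN, hM, e.symm⟩

theorem WittEquiv.trans {X Y Z : QuadSpace F} (h : WittEquiv X Y) (k : WittEquiv Y Z) :
    WittEquiv X Z := by
  obtain ⟨M, N, hM, hN, e⟩ := h
  obtain ⟨K, L, hK, hL, f⟩ := k
  refine ⟨M.sum K, L.sum N, hM.prod hK, hL.prod hN, ?_⟩
  exact (quadProd_assoc _ _ _).symm.trans <| (QuadraticMap.Equivalent.prod e (.refl _)).trans <|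
    (quadProd_right_comm _ _ _).trans <| (QuadraticMap.Equivalent.prod f (.refl _)).trans <|
    quadProd_assoc _ _ _

theorem WittEquiv.of_hyperbolic {X : QuadSpace F} (h : IsHyperbolic X.form) :
    WittEquiv X (zero F) :=
  ⟨zero F, X, zero_hyperbolic, h, quadProd_comm _ _⟩

theorem WittEquiv.sum_left {X X' : QuadSpace F} (h : WittEquiv X X') (Y : QuadSpace F) :
    WittEquiv (X.sum Y) (X'.sum Y) := by
  obtain ⟨M, N, hM, hN, e⟩ := h
  exact ⟨M, N, hM, hN, (quadProd_right_comm _ _ _).trans <|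
    (QuadraticMap.Equivalent.prod e (.refl _)).trans (quadProd_right_comm _ _ _)⟩

theorem WittEquiv.sum_comm (X Y : QuadSpace F) : WittEquiv (X.sum Y) (Y.sum X) :=
  .of_isometry (quadProd_comm _ _)

theorem WittEquiv.sum {X X' Y Y' : QuadSpace F} (h : WittEquiv X X') (k : WittEquiv Y Y') :
    WittEquiv (X.sum Y) (X'.sum Y') :=
  (h.sum_left Y).trans <| (WittEquiv.sum_comm _ _).trans <|
    (k.sum_left X').trans (WittEquiv.sum_comm _ _)

theorem neg_sum_hyperbolic (X : QuadSpace F) : IsHyperbolic (X.neg.sum X).form := by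
  change IsHyperbolic (QuadraticMap.prod (-X.form) X.form)
  refine hyperbolic_of_lagrangian (QuadraticMap.prod (-X.form) X.form) (X.neg.sum X).nonsingular
    (LinearMap.range ((LinearMap.id : X.carrier →ₗ[F] X.carrier).prod LinearMap.id)) ?_ ?_
  · rintro _ ⟨x, rfl⟩
    exact neg_add_cancel (X.form x)
  · rw [LinearMap.finrank_range_of_inj, Module.finrank_prod, two_mul]
    exact fun x y h => congr_arg Prod.fst h

theorem neg_hyperbolic {X : QuadSpace F} (h : IsHyperbolic X.form) : IsHyperbolic X.neg.form := by
  obtain ⟨U, hU, hd⟩ := h.exists_lagrangian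
  exact X.neg.isHyperbolic_of_lagrangian U (fun x hx => neg_eq_zero.2 (hU x hx)) hd

theorem WittEquiv.neg {X Y : QuadSpace F} (h : WittEquiv X Y) : WittEquiv X.neg Y.neg := by
  obtain ⟨M, N, hM, hN, ⟨e⟩⟩ := h
  refine ⟨M.neg, N.neg, neg_hyperbolic hM, neg_hyperbolic hN, ⟨e.toLinearEquiv, fun x => ?_⟩⟩
  exact (neg_add _ _).symm.trans ((congr_arg Neg.neg (e.map_app' x)).trans (neg_add _ _))

theorem metabolic_tensor_hyperbolic {B : BilinSpace F} (h : IsMetabolic B.form)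
    (X : QuadSpace F) : IsHyperbolic (tensor B X).form := by
  obtain ⟨U, hU, hd⟩ := h
  change IsHyperbolic (bilinTensorQuad B.form X.form)
  refine hyperbolic_of_lagrangian (bilinTensorQuad B.form X.form) (tensor B X).nonsingular
    (LinearMap.range (TensorProduct.map U.subtype (LinearMap.id (M := X.carrier)))) ?_ ?_
  · rintro _ ⟨z, rfl⟩
    have h0 : (bilinTensorQuad B.form X.form).comp
        (TensorProduct.map U.subtype (LinearMap.id (M := X.carrier))) = 0 := by
      refine quad_tensor_ext (fun u w => ?_) ?_
      · simp [bilinTensorQuad_tmul, hU _ u.2 _ u.2]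
      · rw [QuadraticMap.polarBilin_comp, polar_bilinTensorQuad B.symm]
        ext u w u' w'
        simp [hU _ u.2 _ u'.2, QuadraticMap.polar]
    exact QuadraticMap.congr_fun h0 z
  · rw [finrank_range_lTensor, Module.finrank_tensorProduct, hd, mul_assoc]

theorem tensor_hyperbolic (B : BilinSpace F) {X : QuadSpace F} (h : IsHyperbolic X.form) :
    IsHyperbolic (tensor B X).form := by
  obtain ⟨U, hU, hd⟩ := h.exists_lagrangian
  change IsHyperbolic (bilinTensorQuad B.form X.form)
  refine hyperbolic_of_lagrangian (bilinTensorQuad B.form X.form) (tensor B X).nonsingular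
    (LinearMap.range (TensorProduct.map (LinearMap.id (M := B.carrier)) U.subtype)) ?_ ?_
  · rintro _ ⟨z, rfl⟩
    have h0 : (bilinTensorQuad B.form X.form).comp
        (TensorProduct.map (LinearMap.id (M := B.carrier)) U.subtype) = 0 := by
      refine quad_tensor_ext (fun u w => ?_) ?_
      · simp [bilinTensorQuad_tmul, hU _ w.2]
      · rw [QuadraticMap.polarBilin_comp, polar_bilinTensorQuad B.symm]
        ext u w u' w'
        simp [QuadraticMap.polar, hU _ w.2, hU _ w'.2, hU _ (U.add_mem w.2 w'.2)]
    exact QuadraticMap.congr_fun h0 z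
  · rw [LinearMap.finrank_range_of_inj, Module.finrank_tensorProduct,
      Module.finrank_tensorProduct, hd, mul_left_comm]
    exact Module.Flat.lTensor_preserves_injective_linearMap (M := B.carrier) U.subtype
      U.injective_subtype

theorem WittEquiv.tensor {B B' : BilinSpace F} {X X' : QuadSpace F} (h : B.WittEquiv B')
    (k : WittEquiv X X') : WittEquiv (tensor B X) (tensor B' X') := by
  have h1 : WittEquiv (QuadSpace.tensor B X) (QuadSpace.tensor B' X) := by
    obtain ⟨M, N, hM, hN, e⟩ := h
    refine ⟨QuadSpace.tensor M X, QuadSpace.tensor N X, metabolic_tensor_hyperbolic hM X,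
      metabolic_tensor_hyperbolic hN X, ?_⟩
    exact (bilinSum_tensorQuad B.symm M.symm _).symm.trans <|
      (bilinTensorQuad_congr (B.sum M).symm (B'.sum N).symm e (.refl _)).trans
        (bilinSum_tensorQuad B'.symm N.symm _)
  refine h1.trans ?_
  obtain ⟨M, N, hM, hN, e⟩ := k
  refine ⟨QuadSpace.tensor B' M, QuadSpace.tensor B' N, tensor_hyperbolic B' hM,
    tensor_hyperbolic B' hN, ?_⟩
  exact (bilinTensorQuad_prod B'.symm _ _).symm.trans <|
    (bilinTensorQuad_congr B'.symm B'.symm (.refl _) e).trans (bilinTensorQuad_prod B'.symm _ _)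

variable (F) in
/-- Witt equivalence as a setoid. -/
def setoid : Setoid (QuadSpace F) :=
  ⟨WittEquiv, fun _ => .of_isometry (.refl _), .symm, .trans⟩

end QuadSpace

/-- The Witt group `W_q(F)` of nonsingular quadratic forms. -/
def QuadWitt (F : Type u) [Field F] : Type (u + 1) := Quotient (QuadSpace.setoid F)

namespace QuadWitt

variable {F : Type u} [Field F]

/-- The Witt class of a nonsingular quadratic form. -/
def mk (X : QuadSpace F) : QuadWitt F := Quotient.mk (QuadSpace.setoid F) X

theorem mk_eq {X Y : QuadSpace F} : mk X = mk Y ↔ X.WittEquiv Y :=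
  Quotient.eq (r := QuadSpace.setoid F)

theorem mk_eq_of_isometry {X Y : QuadSpace F} (h : X.form.Equivalent Y.form) : mk X = mk Y :=
  mk_eq.2 (.of_isometry h)

theorem ind {P : QuadWitt F → Prop} (h : ∀ X, P (mk X)) (w : QuadWitt F) : P w :=
  Quotient.inductionOn w h

instance : Zero (QuadWitt F) := ⟨mk (.zero F)⟩
instance : Add (QuadWitt F) :=
  ⟨Quotient.map₂ QuadSpace.sum fun _ _ h _ _ k => QuadSpace.WittEquiv.sum h k⟩
instance : Neg (QuadWitt F) :=
  ⟨Quotient.map QuadSpace.neg fun _ _ h => QuadSpace.WittEquiv.neg h⟩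
instance : SMul (WittRing F) (QuadWitt F) :=
  ⟨Quotient.map₂ QuadSpace.tensor fun _ _ h _ _ k => QuadSpace.WittEquiv.tensor h k⟩

theorem zero_def : (0 : QuadWitt F) = mk (.zero F) := rfl
theorem mk_add (X Y : QuadSpace F) : mk X + mk Y = mk (X.sum Y) := rfl
theorem mk_neg (X : QuadSpace F) : -mk X = mk X.neg := rfl
theorem mk_smul (B : BilinSpace F) (X : QuadSpace F) :
    WittRing.mk B • mk X = mk (QuadSpace.tensor B X) := rfl

protected theorem add_comm' (a b : QuadWitt F) : a + b = b + a := by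
  induction a using ind with | _ X
  induction b using ind with | _ Y
  exact mk_eq_of_isometry (quadProd_comm _ _)

protected theorem zero_add' (a : QuadWitt F) : 0 + a = a := by
  induction a using ind with | _ X
  refine mk_eq_of_isometry ⟨⟨LinearEquiv.uniqueProd (M₂ := PUnit.{u + 1}), fun x => ?_⟩⟩
  exact (zero_add _).symm

instance : AddCommGroup (QuadWitt F) where
  add_assoc a b c := by
    induction a using ind with | _ X
    induction b using ind with | _ Y
    induction c using ind with | _ Z
    exact mk_eq_of_isometry (quadProd_assoc _ _ _)
  zero_add := QuadWitt.zero_add'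
  add_zero a := by rw [QuadWitt.add_comm', QuadWitt.zero_add']
  add_comm := QuadWitt.add_comm'
  nsmul := nsmulRec
  zsmul := zsmulRec
  neg_add_cancel a := by
    induction a using ind with | _ X
    exact mk_eq.2 (.of_hyperbolic X.neg_sum_hyperbolic)

/-- The action of the Witt ring on the quadratic Witt group by tensor product. -/
instance : Module (WittRing F) (QuadWitt F) where
  one_smul a := by
    induction a using ind with | _ X
    exact mk_eq_of_isometry (bilinTensorQuad_one _)
  mul_smul b c a := by
    induction a using ind with | _ X
    induction b using WittRing.ind with | _ B
    induction c using WittRing.ind with | _ C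
    exact mk_eq_of_isometry (bilinTensorQuad_assoc B.symm C.symm _)
  smul_zero b := by
    induction b using WittRing.ind with | _ B
    exact mk_eq.2 (.of_hyperbolic (QuadSpace.tensor_hyperbolic B QuadSpace.zero_hyperbolic))
  smul_add b x y := by
    induction b using WittRing.ind with | _ B
    induction x using ind with | _ X
    induction y using ind with | _ Y
    exact mk_eq_of_isometry (bilinTensorQuad_prod B.symm _ _)
  add_smul b c x := by
    induction b using WittRing.ind with | _ B
    induction c using WittRing.ind with | _ C
    induction x using ind with | _ X
    exact mk_eq_of_isometry (bilinSum_tensorQuad B.symm C.symm _)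
  zero_smul x := by
    induction x using ind with | _ X
    exact mk_eq.2
      (.of_hyperbolic (QuadSpace.metabolic_tensor_hyperbolic BilinSpace.zero_metabolic X))

end QuadWitt

/-- `I_q^m(F) = I(F)^(m-1) ⊗ W_q(F)`, for `m ≥ 1`: the submodule of `W_q(F)` generated by the
products of an element of `I(F)^(m-1)` and an element of `W_q(F)`. -/
def Iq (F : Type u) [Field F] (m : ℕ) : Submodule (WittRing F) (QuadWitt F) :=
  (WittRing.fundamentalIdeal F) ^ (m - 1) • (⊤ : Submodule (WittRing F) (QuadWitt F))

/-! ### The transfer -/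

section Transfer

variable {F L : Type u} [Field F] [Field L] [Algebra F L]

section

variable {V : Type*} [AddCommGroup V] [Module L V] [Module F V] [IsScalarTower F L V]

theorem transfer_nonsingular {s : L →ₗ[F] F} (hs : s ≠ 0) {q : QuadraticForm L V}
    (hq : q.polarBilin.Nondegenerate) : (s.compQuadraticMap' q).polarBilin.Nondegenerate := by
  refine nondeg_of_symm (polarBilin_symm _) fun x hx => hq.1 x fun y => ?_
  by_contra hne
  refine hs (LinearMap.ext fun a => ?_)
  have h1 : q.polarBilin x ((a * (q.polarBilin x y)⁻¹) • y) = a := by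
    rw [map_smul, smul_eq_mul, inv_mul_cancel_right₀ hne]
  have h2 : s (q.polarBilin x ((a * (q.polarBilin x y)⁻¹) • y)) = 0 := by
    have h3 : s (q (x + (a * (q.polarBilin x y)⁻¹) • y)) - s (q x) -
        s (q ((a * (q.polarBilin x y)⁻¹) • y)) = 0 := hx ((a * (q.polarBilin x y)⁻¹) • y)
    rw [← map_sub, ← map_sub] at h3
    exact h3
  rw [← h1, h2, LinearMap.zero_apply]

theorem transfer_isHyperbolic [FiniteDimensional F L] [FiniteDimensional L V] {s : L →ₗ[F] F} (hs : s ≠ 0)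
    {q : QuadraticForm L V} (hq : q.polarBilin.Nondegenerate) (h : IsHyperbolic q) :
    IsHyperbolic (s.compQuadraticMap' q) := by
  obtain ⟨U, hU, hd⟩ := h.exists_lagrangian
  have : FiniteDimensional F V := Module.Finite.trans L V
  refine hyperbolic_of_lagrangian _ (transfer_nonsingular hs hq) (U.restrictScalars F) ?_ ?_
  · intro x hx
    simp [hU x hx]
  · have h1 := Module.finrank_mul_finrank F L V
    have h2 := Module.finrank_mul_finrank F L U
    change Module.finrank F V = 2 * Module.finrank F U
    rw [← h1, ← h2, hd, mul_left_comm]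

end

variable [FiniteDimensional F L]

/-- For `s : L → F` linear and nonzero and a nonsingular quadratic form `q` on a space `V` over
`L`, the form `s ∘ q` on `V`, viewed as a space over `F`. -/
def QuadSpace.transfer (s : L →ₗ[F] F) (hs : s ≠ 0) (X : QuadSpace L) : QuadSpace F :=
  letI : Module F X.carrier := Module.restrictScalars F L X.carrier
  haveI : IsScalarTower F L X.carrier := IsScalarTower.restrictScalars F L X.carrier
  { carrier := X.carrier
    finite := Module.Finite.trans L X.carrier
    form := s.compQuadraticMap' X.form
    nonsingular := transfer_nonsingular hs X.nonsingular }

theorem QuadSpace.transfer_hyperbolic (s : L →ₗ[F] F) (hs : s ≠ 0) {X : QuadSpace L}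
    (h : IsHyperbolic X.form) : IsHyperbolic (X.transfer s hs).form :=
  let _ : Module F X.carrier := Module.restrictScalars F L X.carrier
  have _ : IsScalarTower F L X.carrier := IsScalarTower.restrictScalars F L X.carrier
  transfer_isHyperbolic (V := X.carrier) hs X.nonsingular h

theorem QuadSpace.transfer_isometry (s : L →ₗ[F] F) (hs : s ≠ 0) {X Y : QuadSpace L}
    (h : X.form.Equivalent Y.form) :
    (X.transfer s hs).form.Equivalent (Y.transfer s hs).form := by
  obtain ⟨e⟩ := h
  let _ : Module F X.carrier := Module.restrictScalars F L X.carrier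
  have _ : IsScalarTower F L X.carrier := IsScalarTower.restrictScalars F L X.carrier
  let _ : Module F Y.carrier := Module.restrictScalars F L Y.carrier
  have _ : IsScalarTower F L Y.carrier := IsScalarTower.restrictScalars F L Y.carrier
  exact ⟨⟨e.toLinearEquiv.restrictScalars F, fun x => congr_arg s (e.map_app' x)⟩⟩

theorem QuadSpace.transfer_sum (s : L →ₗ[F] F) (hs : s ≠ 0) (X Y : QuadSpace L) :
    ((X.sum Y).transfer s hs).form.Equivalent ((X.transfer s hs).sum (Y.transfer s hs)).form := by
  let e : ((X.sum Y).transfer s hs).carrier ≃ₗ[F]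
      ((X.transfer s hs).sum (Y.transfer s hs)).carrier :=
    { toFun := fun x => x
      invFun := fun x => x
      map_add' := fun _ _ => rfl
      map_smul' := fun _ _ => rfl
      left_inv := fun _ => rfl
      right_inv := fun _ => rfl }
  exact ⟨⟨e, fun x => (map_add s _ _).symm⟩⟩

theorem QuadSpace.WittEquiv.transfer (s : L →ₗ[F] F) (hs : s ≠ 0) {X Y : QuadSpace L}
    (h : X.WittEquiv Y) : (X.transfer s hs).WittEquiv (Y.transfer s hs) := by
  obtain ⟨M, N, hM, hN, e⟩ := h
  exact ⟨M.transfer s hs, N.transfer s hs, QuadSpace.transfer_hyperbolic s hs hM,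
    QuadSpace.transfer_hyperbolic s hs hN, (QuadSpace.transfer_sum s hs X M).symm.trans
      ((QuadSpace.transfer_isometry s hs e).trans (QuadSpace.transfer_sum s hs Y N))⟩

/-- The Scharlau transfer `W_q(L) → W_q(F)` induced by a nonzero `F`-linear map `s : L → F`. -/
def scharlauTransfer (s : L →ₗ[F] F) (hs : s ≠ 0) : QuadWitt L →+ QuadWitt F where
  toFun := Quotient.map (QuadSpace.transfer s hs) fun _ _ h => QuadSpace.WittEquiv.transfer s hs h
  map_zero' := QuadWitt.mk_eq.2
    (.of_hyperbolic (QuadSpace.transfer_hyperbolic s hs QuadSpace.zero_hyperbolic))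
  map_add' a b := by
    induction a using QuadWitt.ind with | _ X
    induction b using QuadWitt.ind with | _ Y
    exact QuadWitt.mk_eq_of_isometry (QuadSpace.transfer_sum s hs X Y)

theorem scharlauTransfer_mk (s : L →ₗ[F] F) (hs : s ≠ 0) (X : QuadSpace L) :
    scharlauTransfer s hs (QuadWitt.mk X) = QuadWitt.mk (X.transfer s hs) := rfl

end Transfer

section AdjoinRoot

open Polynomial

variable {F : Type u} [Field F]

/-- For `p` monic of degree `d`, the linear functional on `F[x]/(p)` that sends the class of a
polynomial `f` to the coefficient of `x^(d-1)` in the remainder of `f` modulo `p`. -/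
def topCoeff {p : F[X]} (hp : p.Monic) : AdjoinRoot p →ₗ[F] F :=
  Polynomial.lcoeff F (p.natDegree - 1) ∘ₗ AdjoinRoot.modByMonicHom hp

theorem topCoeff_root_pow {p : F[X]} (hp : p.Monic) {i : ℕ} (hi : i < p.natDegree) :
    topCoeff hp (AdjoinRoot.root p ^ i) = if i = p.natDegree - 1 then 1 else 0 := by
  have h : AdjoinRoot.root p ^ i = AdjoinRoot.mk p (X ^ i) := by simp
  have h2 : (X ^ i : F[X]) %ₘ p = X ^ i := by
    rw [Polynomial.modByMonic_eq_self_iff hp, degree_X_pow, degree_eq_natDegree hp.ne_zero]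
    exact_mod_cast hi
  rw [h, topCoeff, LinearMap.comp_apply, AdjoinRoot.modByMonicHom_mk, h2, lcoeff_apply,
    coeff_X_pow]
  simp [eq_comm]

theorem topCoeff_ne_zero {p : F[X]} (hp : p.Monic) (hirr : Irreducible p) : topCoeff hp ≠ 0 := by
  intro h
  have hd := hirr.natDegree_pos
  have := topCoeff_root_pow hp (i := p.natDegree - 1) (by omega)
  simp [h] at this

/-- For `p` monic irreducible, the Scharlau transfer `W_q(F[x]/(p)) → W_q(F)` induced by
`topCoeff`. -/
def polyTransfer {p : F[X]} [hirr : Fact (Irreducible p)] (hp : p.Monic) :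
    QuadWitt (AdjoinRoot p) →+ QuadWitt F :=
  haveI : FiniteDimensional F (AdjoinRoot p) := hp.finite_adjoinRoot
  scharlauTransfer (topCoeff hp) (topCoeff_ne_zero hp hirr.out)

end AdjoinRoot

end WittTheory

end

/-! Write `L` for `AdjoinRoot p`, a simple extension `F[α]`. The classes of `[a, c] = a X² + X Y + c
Y²` generate `W_q(L)` and are biadditive in `a` and `c`, so `symbol` presents `W_q(L)` as a quotient
of the ring `L ⊗[ℤ] L`. There `⟨d⟩` acts as multiplication by `d ⊗ d⁻¹`, hence `⟨d⟩ - 1` acts as a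
multiple of `d ⊗ 1 - 1 ⊗ d`. As the `⟨d⟩ - 1` generate `I(L)`, the group `I(L)ⁿ W_q(L)` lies in the
image of `Jⁿ`, where `J = diffIdeal L L` is generated by all these differences. The differences of
squares generate an ideal `N = squareIdeal L` that `symbol` kills, because `⟨x²⟩ = 1`.

Differences `d ⊗ 1 - 1 ⊗ d` with `d` in `F` pass through the transfer and become factors in `I(F)`.
It therefore suffices to compare `Jⁿ`, modulo `N`, with powers of the ideal `K = diffIdeal F L`
generated by those differences.

If `L/F` is separable, then `L = F[L²]`, so `J ⊆ K + N` and the powers match exactly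
(`scharlauTransfer_pow_of_adjoin_sq`). If `L = F[α]` is purely inseparable of even degree, then `J`
is generated by `K` and the difference of `α`, whose square is in `N`; thus `Jⁿ⁺¹ ⊆ Kⁿ + N`, one
power short. The missing power comes from another source. One has `[a, c] = ⟨a⟩[1, ac] = ⟨a⟩[1,
(ac)^(2^k)]` with `(ac)^(2^k)` in `F` for some `k`, so by Frobenius reciprocity its transfer is a
multiple of the even-dimensional form `(x, y) ↦ s (a x y)`: every transfer already lies in `I(F)
W_q(F)` (`scharlauTransfer_pow_of_isPurelyInseparable`).

In general one goes through the separable closure of `F` in `L`. The choice of functional is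
immaterial, since two nonzero functionals differ by multiplication by a unit `u` of `L`, which
twists forms by `⟨u⟩` and preserves `I(L)ⁿ W_q(L)`. -/

noncomputable section

namespace WittTheory

open TensorProduct
open LinearMap (BilinForm)

universe u

/-! ### Splitting off nondegenerate subspaces -/

section Splitting

variable {F : Type*} [Field F]
variable {V : Type*} [AddCommGroup V] [Module F V]
variable {W : Type*} [AddCommGroup W] [Module F W]

/-- The subspace of vectors that are orthogonal to the range of `φ`. -/
def rangeOrthogonal (B : BilinForm F V) (φ : W →ₗ[F] V) : Submodule F V where
  carrier := {x | ∀ y, B (φ y) x = 0}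
  zero_mem' := by simp
  add_mem' hx hy z := by rw [map_add, hx z, hy z, add_zero]
  smul_mem' c x hx z := by rw [map_smul, hx z, smul_zero]

/-- A nondegenerate subspace, given by an isometric map, is an orthogonal summand. -/
def orthogonalSplitting [FiniteDimensional F W] {B : BilinForm F V} {C : BilinForm F W}
    (hC : C.Nondegenerate) (hCs : ∀ x y, C x y = C y x) (φ : W →ₗ[F] V)
    (h : ∀ x y, B (φ x) (φ y) = C x y) : (W × rangeOrthogonal B φ) ≃ₗ[F] V :=
  LinearEquiv.ofBijective (φ.coprod (rangeOrthogonal B φ).subtype) (by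
    constructor
    · rw [injective_iff_map_eq_zero]
      rintro ⟨w, z⟩ hwz
      rw [LinearMap.coprod_apply, Submodule.subtype_apply] at hwz
      have hw : w = 0 := hC.2 w fun y => by
        have := congr_arg (B (φ y)) hwz
        rwa [map_add, h, z.2 y, add_zero, map_zero] at this
      subst hw
      rw [map_zero, zero_add] at hwz
      exact Prod.ext rfl (Subtype.ext hwz)
    · intro x
      -- The orthogonal projection of `x`: nondegeneracy of `C` lets `w` represent the functional `y
      -- ↦ B (φ y) x`.
      let w : W := (C.toDual hC).symm ((B.flip x) ∘ₗ φ)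
      have hw : ∀ y, C w y = B (φ y) x := fun y => by
        have : C.toDual hC w = (B.flip x) ∘ₗ φ := LinearEquiv.apply_symm_apply _ _
        rw [← LinearMap.BilinForm.toDual_def hC, this]
        rfl
      refine ⟨(w, ⟨x - φ w, fun y => ?_⟩), ?_⟩
      · rw [map_sub, h, hCs, hw, sub_self]
      · simp)

theorem orthogonalSplitting_apply [FiniteDimensional F W] {B : BilinForm F V} {C : BilinForm F W}
    (hC : C.Nondegenerate) (hCs : ∀ x y, C x y = C y x) (φ : W →ₗ[F] V)
    (h : ∀ x y, B (φ x) (φ y) = C x y) (x : W × rangeOrthogonal B φ) :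
    orthogonalSplitting hC hCs φ h x = φ x.1 + x.2 := rfl

/-- A vector of the complement is orthogonal to the range of `φ` by definition; if it is also
orthogonal to the complement, it is orthogonal to all of `V`. -/
theorem rangeOrthogonal_separating [FiniteDimensional F W] {B : BilinForm F V} {C : BilinForm F W}
    (hB : B.Nondegenerate) (hBs : ∀ x y, B x y = B y x)
    (hC : C.Nondegenerate) (hCs : ∀ x y, C x y = C y x) (φ : W →ₗ[F] V)
    (h : ∀ x y, B (φ x) (φ y) = C x y) (x : rangeOrthogonal B φ)
    (hx : ∀ y : rangeOrthogonal B φ, B x y = 0) : x = 0 := by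
  refine Subtype.ext (hB.1 _ fun y => ?_)
  obtain ⟨⟨w, z⟩, rfl⟩ := (orthogonalSplitting hC hCs φ h).surjective y
  rw [orthogonalSplitting_apply, map_add, hx z, hBs, x.2 w, add_zero]

end Splitting

theorem BilinSpace.exists_equivalent_sum {F : Type u} [Field F] (X Y : BilinSpace F)
    (φ : Y.carrier →ₗ[F] X.carrier) (h : ∀ x y, X.form (φ x) (φ y) = Y.form x y) :
    ∃ Z : BilinSpace F, (Y.sum Z).form.Equivalent X.form := by
  refine ⟨{ carrier := rangeOrthogonal X.form φ
            form := X.form.restrict _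
            symm := fun x y => X.symm x y
            nondegenerate := nondeg_of_symm (fun x y => X.symm x y) (rangeOrthogonal_separating
              X.nondegenerate X.symm Y.nondegenerate Y.symm φ h) },
    ⟨⟨orthogonalSplitting Y.nondegenerate Y.symm φ h, ?_⟩⟩⟩
  rintro ⟨y, z⟩ ⟨y', z'⟩
  change X.form (φ y + z) (φ y' + z') = Y.form y y' + X.form z z'
  rw [map_add, map_add, LinearMap.add_apply, LinearMap.add_apply, h, z'.2 y, X.symm z, z.2 y']
  ring

theorem QuadSpace.exists_equivalent_sum {F : Type u} [Field F] (X Y : QuadSpace F)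
    (φ : Y.carrier →ₗ[F] X.carrier) (h : ∀ x, X.form (φ x) = Y.form x) :
    ∃ Z : QuadSpace F, (Y.sum Z).form.Equivalent X.form := by
  have h' : ∀ x y, X.form.polarBilin (φ x) (φ y) = Y.form.polarBilin x y := fun x y => by
    simp [QuadraticMap.polar, ← map_add, h]
  refine ⟨{ carrier := rangeOrthogonal X.form.polarBilin φ
            form := X.form.restrict _
            nonsingular := nondeg_of_symm (polarBilin_symm _) (rangeOrthogonal_separating
              X.nonsingular (polarBilin_symm _) Y.nonsingular (polarBilin_symm _) φ h') },
    ⟨⟨orthogonalSplitting Y.nonsingular (polarBilin_symm _) φ h', ?_⟩⟩⟩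
  rintro ⟨y, z⟩
  change X.form (φ y + z) = Y.form y + X.form z
  have := z.2 y
  rw [QuadraticMap.polarBilin_apply_apply, QuadraticMap.polar, h] at this
  linear_combination this

/-! ### Generators of the Witt ring -/

section Angle

variable {F : Type u} [Field F]

/-- The one-dimensional form `⟨d⟩`. -/
def BilinSpace.angle (d : Fˣ) : BilinSpace F where
  carrier := F
  form := (d : F) • LinearMap.mul F F
  symm x y := by simp [mul_comm x]
  nondegenerate := nondeg_of_symm (fun x y => by simp [mul_comm x]) fun x hx => by
    simpa using hx 1

/-- The bilinear form `x₁ y₂ + x₂ y₁`. -/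
def planeForm (F : Type u) [Field F] : BilinForm F (F × F) :=
  (LinearMap.mul F F).compl₁₂ (LinearMap.fst F F F) (LinearMap.snd F F F) +
    (LinearMap.mul F F).compl₁₂ (LinearMap.snd F F F) (LinearMap.fst F F F)

theorem planeForm_apply (x y : F × F) : planeForm F x y = x.1 * y.2 + x.2 * y.1 := rfl

theorem planeForm_metabolic : IsMetabolic (planeForm F) := by
  refine ⟨LinearMap.range (LinearMap.inl F F F), ?_, ?_⟩
  · rintro _ ⟨x, rfl⟩ _ ⟨y, rfl⟩
    simp [planeForm_apply]
  · rw [LinearMap.finrank_range_of_inj LinearMap.inl_injective]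
    simp

/-- The hyperbolic plane, as a bilinear form. -/
def BilinSpace.plane (F : Type u) [Field F] : BilinSpace F where
  carrier := F × F
  form := planeForm F
  symm x y := by rw [planeForm_apply, planeForm_apply]; ring
  nondegenerate := by
    refine nondeg_of_symm (fun x y => by rw [planeForm_apply, planeForm_apply]; ring) ?_
    intro x hx
    refine Prod.ext ?_ ?_
    · simpa [planeForm_apply] using hx (0, 1)
    · simpa [planeForm_apply] using hx (1, 0)

namespace WittRing

/-- The class of `⟨d⟩` in the Witt ring. -/
def angle (d : Fˣ) : WittRing F := mk (.angle d)

/-- Induction on the dimension. A vector with `B v v ≠ 0` splits off a form `⟨d⟩`. If there is none,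
the form is alternating, and a nonzero vector splits off a hyperbolic plane, whose class is zero. -/
theorem mk_mem_closure_angle (n : ℕ) : ∀ X : BilinSpace F, Module.finrank F X.carrier = n →
    mk X ∈ AddSubgroup.closure (Set.range (angle (F := F))) := by
  induction n using Nat.strong_induction_on with
  | _ n ih =>
    intro X hX
    have split : ∀ (Y : BilinSpace F) (φ : Y.carrier →ₗ[F] X.carrier),
        (∀ x y, X.form (φ x) (φ y) = Y.form x y) → 0 < Module.finrank F Y.carrier →
        mk Y ∈ AddSubgroup.closure (Set.range (angle (F := F))) →
        mk X ∈ AddSubgroup.closure (Set.range (angle (F := F))) := by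
      intro Y φ h hY hm
      obtain ⟨Z, hZ⟩ := X.exists_equivalent_sum Y φ h
      rw [← mk_eq_of_isometry hZ, ← mk_add]
      obtain ⟨e⟩ := hZ
      have hd : Module.finrank F (Y.carrier × Z.carrier) = Module.finrank F X.carrier :=
        e.toLinearEquiv.finrank_eq
      rw [Module.finrank_prod] at hd
      exact add_mem hm (ih _ (by omega) Z rfl)
    by_cases hv : ∃ v, X.form v v ≠ 0
    · obtain ⟨v, hv⟩ := hv
      have hs : ∀ x y : F, X.form (x • v) (y • v) = X.form v v * (x * y) := fun x y => by
        rw [map_smul, map_smul, LinearMap.smul_apply, smul_eq_mul, smul_eq_mul]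
        ring
      refine split (.angle (Units.mk0 _ hv)) (LinearMap.toSpanSingleton F _ v) hs ?_
        (AddSubgroup.subset_closure ⟨_, rfl⟩)
      exact (Module.finrank_self F).symm ▸ one_pos
    push Not at hv
    by_cases h0 : ∃ v : X.carrier, v ≠ 0
    · obtain ⟨v, hv0⟩ := h0
      obtain ⟨w, hw⟩ : ∃ w, X.form v w = 1 := by
        by_contra! hne
        refine hv0 (X.nondegenerate.1 v fun y => ?_)
        by_contra hy
        exact hne ((X.form v y)⁻¹ • y) (by rw [map_smul, smul_eq_mul, inv_mul_cancel₀ hy])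
      refine split (.plane F) ((LinearMap.toSpanSingleton F _ v).coprod
        (LinearMap.toSpanSingleton F _ w)) (fun x y => ?_) ?_ ?_
      · change X.form ((x : F × F).1 • v + (x : F × F).2 • w)
          ((y : F × F).1 • v + (y : F × F).2 • w) = _
        simp only [map_add, map_smul, LinearMap.add_apply, LinearMap.smul_apply, hv, hw,
          X.symm w v, smul_eq_mul]
        refine Eq.trans ?_ (planeForm_apply (F := F) x y).symm
        ring
      · change 0 < Module.finrank F (F × F)
        simp
      · rw [mk_eq.2 (.of_metabolic (X := .plane F) planeForm_metabolic), ← zero_def]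
        exact zero_mem _
    · push Not at h0
      rw [mk_eq.2 (.of_metabolic ⟨⊥, fun x _ y _ => by simp [h0 x], ?_⟩), ← zero_def]
      · exact zero_mem _
      · have : Subsingleton X.carrier := ⟨fun x y => by rw [h0 x, h0 y]⟩
        rw [Module.finrank_zero_of_subsingleton, finrank_bot]

/-- The Witt ring is generated by the classes of one-dimensional forms. -/
theorem closure_range_angle : AddSubgroup.closure (Set.range (angle (F := F))) = ⊤ :=
  eq_top_iff.2 fun w _ => by
    induction w using ind with | _ X
    exact mk_mem_closure_angle _ X rfl

theorem dimIndex_angle (d : Fˣ) : dimIndex F (angle d) = 1 := by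
  change (Module.finrank F F : ZMod 2) = 1
  simp

theorem angle_sub_one_mem (d : Fˣ) : angle d - 1 ∈ fundamentalIdeal F := by
  rw [fundamentalIdeal, RingHom.mem_ker, map_sub, map_one, dimIndex_angle, sub_self]

theorem angle_eq_one_of_sq (d : Fˣ) : angle (d ^ 2) = 1 := by
  have h : LinearMap.BilinForm.Equivalent (((d ^ 2 : Fˣ) : F) • LinearMap.mul F F)
      (LinearMap.mul F F) := by
    refine ⟨⟨LinearEquiv.smulOfUnit d, fun x y => ?_⟩⟩
    change (d : F) * x * ((d : F) * y) = ((d ^ 2 : Fˣ) : F) * (x * y)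
    rw [Units.val_pow_eq_pow_val]
    ring
  exact mk_eq_of_isometry h

/-- In characteristic two the fundamental ideal is generated by the `⟨d⟩ - 1`. -/
theorem fundamentalIdeal_le_span [CharP F 2] :
    fundamentalIdeal F ≤ Ideal.span (Set.range fun d : Fˣ => angle d - 1) := by
  set K := Ideal.span (Set.range fun d : Fˣ => angle d - 1) with hK
  have hKI : K ≤ fundamentalIdeal F := by
    rw [hK, Ideal.span_le]
    rintro _ ⟨d, rfl⟩
    exact angle_sub_one_mem d
  have two : (2 : WittRing F) = 0 := by
    have hneg : -(1 : WittRing F) = 1 := by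
      have h : LinearMap.BilinForm.Equivalent (-LinearMap.mul F F) (LinearMap.mul F F) := by
        refine ⟨⟨LinearEquiv.refl F F, fun x y => ?_⟩⟩
        change x * y = -(x * y)
        rw [CharTwo.neg_eq]
      exact mk_eq_of_isometry h
    linear_combination (-1 : WittRing F) * hneg
  -- Modulo `K` every `⟨d⟩` is `1` and `2 = 0`, so the quotient has no classes besides `0` and `1`;
  -- the dimension index then excludes `1` for elements of `I(F)`.
  have key : ∀ w : WittRing F, w ∈ K ∨ w - 1 ∈ K := by
    intro w
    have hw : w ∈ AddSubgroup.closure (Set.range (angle (F := F))) := by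
      rw [closure_range_angle]; trivial
    induction hw using AddSubgroup.closure_induction with
    | mem x hx =>
      obtain ⟨d, rfl⟩ := hx
      exact Or.inr (Ideal.subset_span ⟨d, rfl⟩)
    | zero => exact Or.inl (zero_mem _)
    | add x y _ _ hx hy =>
      rcases hx with hx | hx <;> rcases hy with hy | hy
      · exact Or.inl (add_mem hx hy)
      · refine Or.inr ?_
        have := add_mem hx hy
        rwa [← add_sub_assoc] at this
      · refine Or.inr ?_
        have := add_mem hx hy
        rwa [sub_add_eq_add_sub] at this
      · refine Or.inl ?_
        have := add_mem hx hy
        rwa [show x - 1 + (y - 1) = x + y by linear_combination -two] at this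
    | neg x _ hx =>
      rcases hx with hx | hx
      · exact Or.inl (neg_mem hx)
      · refine Or.inr ?_
        have := neg_mem hx
        rwa [show -(x - 1) = -x - 1 by linear_combination two] at this
  intro w hw
  rcases key w with h | h
  · exact h
  · exfalso
    have h1 := hKI h
    rw [fundamentalIdeal, RingHom.mem_ker] at hw h1
    rw [map_sub, hw, map_one] at h1
    exact absurd h1 (by decide)

end WittRing

/-! ### Generators of the quadratic Witt group -/

/-- The quadratic form `a X² + X Y + c Y²`. -/
def binaryForm (a c : F) : QuadraticForm F (F × F) :=
  a • QuadraticMap.linMulLin (LinearMap.fst F F F) (LinearMap.fst F F F) +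
    QuadraticMap.linMulLin (LinearMap.fst F F F) (LinearMap.snd F F F) +
    c • QuadraticMap.linMulLin (LinearMap.snd F F F) (LinearMap.snd F F F)

theorem binaryForm_apply (a c : F) (x : F × F) :
    binaryForm a c x = a * x.1 ^ 2 + x.1 * x.2 + c * x.2 ^ 2 := by
  simp [binaryForm, sq]

theorem binaryForm_polarBilin [CharP F 2] (a c : F) (x y : F × F) :
    (binaryForm a c).polarBilin x y = x.1 * y.2 + y.1 * x.2 := by
  rw [QuadraticMap.polarBilin_apply_apply, QuadraticMap.polar, binaryForm_apply,
    binaryForm_apply, binaryForm_apply, Prod.fst_add, Prod.snd_add]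
  linear_combination (a * x.1 * y.1 + c * x.2 * y.2) * CharTwo.two_eq_zero (R := F)

/-- The space `[a, c]`: the plane with the form `a X² + X Y + c Y²`. -/
def QuadSpace.binary [CharP F 2] (a c : F) : QuadSpace F where
  carrier := F × F
  form := binaryForm a c
  nonsingular := nondeg_of_symm (polarBilin_symm _) fun x hx => by
    refine Prod.ext ?_ ?_
    · have := hx (0, 1)
      rw [binaryForm_polarBilin] at this
      simpa using this
    · have := hx (1, 0)
      rw [binaryForm_polarBilin] at this
      simpa using this

/-- The space `d • q`. -/
def QuadSpace.scale (d : Fˣ) (X : QuadSpace F) : QuadSpace F where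
  carrier := X.carrier
  form := (d : F) • X.form
  nonsingular := nondeg_of_symm (polarBilin_symm _) fun x hx => X.nonsingular.1 x fun y => by
    simpa [QuadraticMap.polar_smul] using hx y

namespace QuadWitt

theorem smul_mul_tensorQuad_equivalent {V : Type*} [AddCommGroup V] [Module F V] (d : F)
    (q : QuadraticForm F V) :
    (bilinTensorQuad (d • LinearMap.mul F F) q).Equivalent (d • q) := by
  refine equivalent_of_tensor (fun x y => by simp [mul_comm x]) (TensorProduct.lid F V) ?_ ?_
  · intro v w
    simp [QuadraticMap.map_smul, mul_assoc]
  · intro v w v' w'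
    simp only [QuadraticMap.polarBilin_apply_apply, FunLike.coe_smul,
      QuadraticMap.polar_smul, TensorProduct.lid_tmul, QuadraticMap.polar_smul_left,
      QuadraticMap.polar_smul_right, LinearMap.smul_apply, LinearMap.mul_apply', smul_eq_mul]
    ring

theorem angle_smul_mk (d : Fˣ) (X : QuadSpace F) :
    WittRing.angle d • mk X = mk (X.scale d) :=
  mk_eq_of_isometry (smul_mul_tensorQuad_equivalent (d : F) X.form)

variable [CharP F 2]

/-- The class of `[a, c]` in the quadratic Witt group. -/
def binary (a c : F) : QuadWitt F := mk (.binary a c)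

/-- Induction on the dimension: a nonzero `v` has a partner `w` with polar value `1`, and the plane
they span is `[q v, q w]`, which splits off. -/
theorem mk_mem_closure_binary (n : ℕ) : ∀ X : QuadSpace F, Module.finrank F X.carrier = n →
    mk X ∈ AddSubgroup.closure (Set.range fun z : F × F => binary z.1 z.2) := by
  induction n using Nat.strong_induction_on with
  | _ n ih =>
    intro X hX
    by_cases h0 : ∃ v : X.carrier, v ≠ 0
    · obtain ⟨v, hv0⟩ := h0
      obtain ⟨w, hw⟩ : ∃ w, X.form.polarBilin v w = 1 := by
        by_contra! hne
        refine hv0 (X.nonsingular.1 v fun y => ?_)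
        by_contra hy
        exact hne ((X.form.polarBilin v y)⁻¹ • y)
          (by rw [map_smul, smul_eq_mul, inv_mul_cancel₀ hy])
      obtain ⟨Z, hZ⟩ := X.exists_equivalent_sum (.binary (X.form v) (X.form w))
        ((LinearMap.toSpanSingleton F _ v).coprod (LinearMap.toSpanSingleton F _ w)) (fun x => by
          have h1 := QuadraticMap.map_add X.form (x.1 • v) (x.2 • w)
          rw [QuadraticMap.polar_smul_left, QuadraticMap.polar_smul_right,
            ← QuadraticMap.polarBilin_apply_apply, hw, QuadraticMap.map_smul,
            QuadraticMap.map_smul] at h1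
          refine h1.trans ?_
          refine Eq.trans ?_ (binaryForm_apply (X.form v) (X.form w) x).symm
          simp only [smul_eq_mul]
          ring)
      rw [← mk_eq_of_isometry hZ, ← mk_add]
      obtain ⟨e⟩ := hZ
      have hd : Module.finrank F ((F × F) × Z.carrier) = Module.finrank F X.carrier :=
        e.toLinearEquiv.finrank_eq
      rw [Module.finrank_prod, Module.finrank_prod, Module.finrank_self] at hd
      exact add_mem (AddSubgroup.subset_closure ⟨(X.form v, X.form w), rfl⟩)
        (ih _ (by omega) Z rfl)
    · push Not at h0
      rw [mk_eq.2 (.of_hyperbolic (X.isHyperbolic_of_lagrangian ⊥ (fun x _ => by simp [h0 x]) ?_)),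
        ← zero_def]
      · exact zero_mem _
      · have : Subsingleton X.carrier := ⟨fun x y => by rw [h0 x, h0 y]⟩
        rw [Module.finrank_zero_of_subsingleton, finrank_bot]

/-- The quadratic Witt group is generated by the classes of binary forms. -/
theorem closure_range_binary :
    AddSubgroup.closure (Set.range fun z : F × F => binary z.1 z.2) = ⊤ :=
  eq_top_iff.2 fun w _ => by
    induction w using ind with | _ X
    exact mk_mem_closure_binary _ X rfl

theorem binary_comm (a c : F) : binary a c = binary c a := by
  have h : (binaryForm a c).Equivalent (binaryForm c a) := by
    refine ⟨⟨LinearEquiv.prodComm F F F, fun x => ?_⟩⟩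
    change binaryForm c a (x.2, x.1) = binaryForm a c x
    rw [binaryForm_apply, binaryForm_apply]
    ring
  exact mk_eq_of_isometry h

theorem binary_zero_right (a : F) : binary a 0 = 0 := by
  have h : IsHyperbolic (binaryForm a 0) := by
    refine hyperbolic_of_lagrangian _ (QuadSpace.binary a 0).nonsingular
      (LinearMap.range (LinearMap.inr F F F)) ?_ ?_
    · rintro _ ⟨x, rfl⟩
      rw [binaryForm_apply]
      simp
    · rw [LinearMap.finrank_range_of_inj LinearMap.inr_injective]
      simp
  exact mk_eq.2 (.of_hyperbolic (X := .binary a 0) h)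

/-- This rests on the isometry `[a + a', c] ⊥ [a', 0] ≅ [a, c] ⊥ [a', c]`, whose extra summand on
the left is hyperbolic. -/
theorem binary_add_left (a a' c : F) : binary (a + a') c = binary a c + binary a' c := by
  have h : binary (a + a') c + binary a' 0 = binary a c + binary a' c := by
    -- In the standard bases `e₁, e₂` and `e₁', e₂'` of the target, the image basis is `e₁ + e₁',
    -- e₂, e₁', e₂ + e₂'`; the last vector has value `c + c = 0`. In characteristic two `f` is its
    -- own inverse.
    let f : ((F × F) × (F × F)) ≃ₗ[F] ((F × F) × (F × F)) :=
      { toFun := fun z => ((z.1.1, z.1.2 + z.2.2), (z.1.1 + z.2.1, z.2.2))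
        invFun := fun z => ((z.1.1, z.1.2 + z.2.2), (z.1.1 + z.2.1, z.2.2))
        map_add' := fun x y => by ext <;> simp <;> ring
        map_smul' := fun x y => by ext <;> simp <;> ring
        left_inv := fun x => by
          ext <;> simp [add_assoc, ← add_assoc (x.1.1) x.1.1, CharTwo.add_self_eq_zero]
        right_inv := fun x => by
          ext <;> simp [add_assoc, ← add_assoc (x.1.1) x.1.1, CharTwo.add_self_eq_zero] }
    have hf : QuadraticMap.Equivalent ((binaryForm (a + a') c).prod (binaryForm a' 0))
        ((binaryForm a c).prod (binaryForm a' c)) := by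
      refine ⟨⟨f, fun x => ?_⟩⟩
      change binaryForm a c (x.1.1, x.1.2 + x.2.2) + binaryForm a' c (x.1.1 + x.2.1, x.2.2) =
        binaryForm (a + a') c x.1 + binaryForm a' 0 x.2
      simp only [binaryForm_apply]
      linear_combination (c * x.2.2 ^ 2 + a' * x.1.1 * x.2.1 + c * x.1.2 * x.2.2 +
        x.1.1 * x.2.2) * CharTwo.two_eq_zero (R := F)
    exact mk_eq_of_isometry hf
  rwa [binary_zero_right, add_zero] at h

theorem binary_add_right (a c c' : F) : binary a (c + c') = binary a c + binary a c' := by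
  rw [binary_comm, binary_add_left, binary_comm c, binary_comm c']

/-- Substitute `d Y` for `Y`: `d (a X² + X Y + c Y²) = d a X² + X (d Y) + d⁻¹ c (d Y)²`. -/
theorem angle_smul_binary (d : Fˣ) (a c : F) :
    WittRing.angle d • binary a c = binary (d * a) ((d : F)⁻¹ * c) := by
  rw [binary, angle_smul_mk]
  have h : QuadraticMap.Equivalent ((d : F) • binaryForm a c)
      (binaryForm (d * a) ((d : F)⁻¹ * c)) := by
    refine ⟨⟨(LinearEquiv.refl F F).prodCongr (LinearEquiv.smulOfUnit d), fun x => ?_⟩⟩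
    change binaryForm (d * a) ((d : F)⁻¹ * c) (x.1, (d : F) * x.2) = (d : F) * binaryForm a c x
    have hd := d.ne_zero
    rw [binaryForm_apply, binaryForm_apply]
    field_simp
  exact mk_eq_of_isometry h

/-- For `x ≠ 0` this is the trivial action of `⟨x²⟩`, written on symbols. It is the relation that
kills `squareIdeal`. -/
theorem binary_sq_mul (x a c : F) : binary (x ^ 2 * a) c = binary a (x ^ 2 * c) := by
  by_cases hx : x = 0
  · subst hx
    rw [zero_pow two_ne_zero, zero_mul, zero_mul, binary_comm, binary_zero_right,
      binary_zero_right]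
  · have h := angle_smul_binary (Units.mk0 x hx ^ 2) a (x ^ 2 * c)
    rw [WittRing.angle_eq_one_of_sq, one_smul] at h
    rw [h]
    congr 1
    simp [hx]

/-- The substitution `X ↦ X + c Y` trades `c²` for `c`. Iterated, it lets the second slot be
replaced by a Frobenius power, which a purely inseparable extension can push into the base field. -/
theorem binary_one_sq (c : F) : binary 1 (c ^ 2) = binary 1 c := by
  let f : (F × F) ≃ₗ[F] (F × F) :=
    { toFun := fun z => (z.1 + c * z.2, z.2)
      invFun := fun z => (z.1 + c * z.2, z.2)
      map_add' := fun x y => by ext <;> simp; ring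
      map_smul' := fun x y => by ext <;> simp; ring
      left_inv := fun x => by ext <;> simp [add_assoc, CharTwo.add_self_eq_zero]
      right_inv := fun x => by ext <;> simp [add_assoc, CharTwo.add_self_eq_zero] }
  have h : (binaryForm 1 (c ^ 2)).Equivalent (binaryForm 1 c) := by
    refine ⟨⟨f, fun x => ?_⟩⟩
    change binaryForm 1 c (x.1 + c * x.2, x.2) = binaryForm 1 (c ^ 2) x
    rw [binaryForm_apply, binaryForm_apply]
    linear_combination (c * x.1 * x.2 + c * x.2 ^ 2) * CharTwo.two_eq_zero (R := F)
  exact mk_eq_of_isometry h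

theorem binary_one_pow_two_pow (c : F) (n : ℕ) : binary 1 (c ^ 2 ^ n) = binary 1 c := by
  induction n with
  | zero => simp
  | succ n ih => rw [pow_succ, pow_mul, binary_one_sq, ih]

end QuadWitt

end Angle

/-! ### The quadratic Witt group as a quotient of a tensor square -/

section Symbol

variable {L : Type u} [Field L]

/-- The difference `d ⊗ 1 - 1 ⊗ d` in the tensor square of a field. -/
def tensorDiff (d : L) : L ⊗[ℤ] L := d ⊗ₜ 1 - 1 ⊗ₜ d

theorem tensorDiff_add (x y : L) : tensorDiff (x + y) = tensorDiff x + tensorDiff y := by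
  simp only [tensorDiff, add_tmul, tmul_add]
  abel

/-- A Leibniz rule: it makes the elements with difference in a given ideal closed under
multiplication. -/
theorem tensorDiff_mul (x y : L) :
    tensorDiff (x * y) = (x ⊗ₜ 1) * tensorDiff y + (1 ⊗ₜ y) * tensorDiff x := by
  simp only [tensorDiff, mul_sub, Algebra.TensorProduct.tmul_mul_tmul, one_mul, mul_one]
  rw [mul_comm y x]
  abel

/-- The ideal of the tensor square generated by the differences of the squares. -/
def squareIdeal (L : Type u) [Field L] : Ideal (L ⊗[ℤ] L) :=
  Ideal.span (Set.range fun x : L => tensorDiff (x ^ 2))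

theorem tensorDiff_sq_mem (x : L) : tensorDiff (x ^ 2) ∈ squareIdeal L :=
  Ideal.subset_span ⟨x, rfl⟩

/-- The ideal of the tensor square generated by the differences of elements of a subfield. -/
def diffIdeal (F L : Type u) [Field F] [Field L] [Algebra F L] : Ideal (L ⊗[ℤ] L) :=
  Ideal.span (Set.range fun x : F => tensorDiff (algebraMap F L x))

/-- By additivity and the Leibniz rule, the elements whose difference lies in `I` form an
`F`-subalgebra, so generators suffice. -/
theorem tensorDiff_mem_of_mem_adjoin {F : Type u} [Field F] [Algebra F L] {I : Ideal (L ⊗[ℤ] L)}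
    (hI : diffIdeal F L ≤ I) {S : Set L} (hS : ∀ x ∈ S, tensorDiff x ∈ I) {x : L}
    (hx : x ∈ Algebra.adjoin F S) : tensorDiff x ∈ I := by
  induction hx using Algebra.adjoin_induction with
  | mem x h => exact hS x h
  | algebraMap r => exact hI (Ideal.subset_span ⟨r, rfl⟩)
  | add x y _ _ hx hy => rw [tensorDiff_add]; exact add_mem hx hy
  | mul x y _ _ hx hy =>
    rw [tensorDiff_mul]
    exact add_mem (I.mul_mem_left _ hy) (I.mul_mem_left _ hx)

theorem diffIdeal_self_le {F : Type u} [Field F] [Algebra F L] {I : Ideal (L ⊗[ℤ] L)}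
    (hI : diffIdeal F L ≤ I) {S : Set L} (hS : ∀ x ∈ S, tensorDiff x ∈ I)
    (h : Algebra.adjoin F S = ⊤) : diffIdeal L L ≤ I := by
  refine Ideal.span_le.2 ?_
  rintro _ ⟨x, rfl⟩
  exact tensorDiff_mem_of_mem_adjoin hI hS (h ▸ Algebra.mem_top)

/-- The left side is the operator by which `⟨d⟩ - 1` acts; this identity links the fundamental ideal
to the diagonal ideal. -/
theorem unit_tmul_inv_sub_one (d : Lˣ) :
    ((d : L) ⊗ₜ[ℤ] (d : L)⁻¹ - 1 : L ⊗[ℤ] L) = tensorDiff (d : L) * (1 ⊗ₜ (d : L)⁻¹) := by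
  rw [tensorDiff, sub_mul, Algebra.TensorProduct.tmul_mul_tmul,
    Algebra.TensorProduct.tmul_mul_tmul, mul_one, one_mul, mul_one, mul_inv_cancel₀ d.ne_zero,
    Algebra.TensorProduct.one_def]

variable [CharP L 2]

/-- Frobenius is additive, since the cross term `2 (x ⊗ x)` vanishes. Hence every difference squares
into `squareIdeal`. -/
theorem tensorDiff_sq (x : L) : tensorDiff x ^ 2 = tensorDiff (x ^ 2) := by
  have h2 : x ⊗ₜ[ℤ] x + x ⊗ₜ[ℤ] x = 0 := by
    rw [← add_tmul, CharTwo.add_self_eq_zero, zero_tmul]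
  have h3 : (1 : L) ⊗ₜ[ℤ] (x ^ 2) + (1 : L) ⊗ₜ[ℤ] (x ^ 2) = 0 := by
    rw [← add_tmul, CharTwo.add_self_eq_zero, zero_tmul]
  have h4 : tensorDiff x ^ 2 = (x ^ 2) ⊗ₜ[ℤ] 1 - (x ⊗ₜ[ℤ] x + x ⊗ₜ[ℤ] x) + 1 ⊗ₜ[ℤ] (x ^ 2) := by
    simp only [tensorDiff, sq, mul_sub, sub_mul, Algebra.TensorProduct.tmul_mul_tmul, one_mul,
      mul_one]
    abel
  rw [h4, h2, tensorDiff, sub_zero, sub_eq_add_neg]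
  congr 1
  exact eq_neg_of_add_eq_zero_left h3

namespace QuadWitt

/-- The additive map `L ⊗ L → W_q(L)` that sends `a ⊗ c` to the class of `[a, c]`. -/
def symbol (L : Type u) [Field L] [CharP L 2] : (L ⊗[ℤ] L) →+ QuadWitt L :=
  TensorProduct.liftAddHom
    (AddMonoidHom.mk' (fun a => AddMonoidHom.mk' (binary a) (binary_add_right a))
      fun a a' => AddMonoidHom.ext fun c => binary_add_left a a' c)
    fun r a c => by
      rw [map_zsmul, map_zsmul]
      rfl

theorem symbol_tmul (a c : L) : symbol L (a ⊗ₜ c) = binary a c := rfl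

theorem symbol_surjective : Function.Surjective (symbol L) := by
  rw [← AddMonoidHom.range_eq_top, eq_top_iff, ← closure_range_binary, AddSubgroup.closure_le]
  rintro _ ⟨z, rfl⟩
  exact ⟨z.1 ⊗ₜ z.2, rfl⟩

theorem angle_smul_symbol (d : Lˣ) (z : L ⊗[ℤ] L) :
    WittRing.angle d • symbol L z = symbol L (((d : L) ⊗ₜ (d : L)⁻¹) * z) := by
  induction z with
  | zero => simp
  | tmul a c => rw [Algebra.TensorProduct.tmul_mul_tmul, symbol_tmul, symbol_tmul,
      angle_smul_binary]
  | add x y hx hy => rw [map_add, smul_add, hx, hy, mul_add, map_add]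

theorem angle_sub_one_smul_symbol (d : Lˣ) (z : L ⊗[ℤ] L) :
    (WittRing.angle d - 1) • symbol L z =
      symbol L (tensorDiff (d : L) * ((1 ⊗ₜ (d : L)⁻¹) * z)) := by
  rw [sub_smul, one_smul, angle_smul_symbol, ← map_sub, ← mul_assoc, ← unit_tmul_inv_sub_one,
    sub_mul, one_mul]

theorem symbol_eq_zero_of_mem_squareIdeal {z : L ⊗[ℤ] L} (hz : z ∈ squareIdeal L) :
    symbol L z = 0 := by
  have key : ∀ (y : L ⊗[ℤ] L) (x : L), symbol L (y * tensorDiff (x ^ 2)) = 0 := by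
    intro y x
    induction y with
    | zero => simp
    | tmul a c =>
      rw [tensorDiff, mul_sub, map_sub, Algebra.TensorProduct.tmul_mul_tmul,
        Algebra.TensorProduct.tmul_mul_tmul, mul_one, mul_one, symbol_tmul, symbol_tmul,
        mul_comm a, mul_comm c, binary_sq_mul, sub_self]
    | add y y' hy hy' => rw [add_mul, map_add, hy, hy', add_zero]
  -- The kernel of `symbol` is a priori only a subgroup, so the induction needs the vanishing of all
  -- multiples of `z`.
  suffices ∀ y : L ⊗[ℤ] L, symbol L (y * z) = 0 by simpa using this 1
  induction hz using Submodule.span_induction with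
  | mem z h =>
    obtain ⟨x, rfl⟩ := h
    exact fun y => key y x
  | zero => simp
  | add x x' _ _ hx hx' => exact fun y => by rw [mul_add, map_add, hx, hx', add_zero]
  | smul a z _ h => exact fun y => by rw [smul_eq_mul, ← mul_assoc, h]

/-- The image of an ideal of the tensor square in the quadratic Witt group. -/
def symbolSubmodule (I : Ideal (L ⊗[ℤ] L)) : Submodule (WittRing L) (QuadWitt L) where
  carrier := symbol L '' I
  zero_mem' := ⟨0, I.zero_mem, map_zero _⟩
  add_mem' := by
    rintro _ _ ⟨x, hx, rfl⟩ ⟨y, hy, rfl⟩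
    exact ⟨x + y, I.add_mem hx hy, map_add _ _ _⟩
  smul_mem' := by
    rintro w _ ⟨x, hx, rfl⟩
    -- Only the `⟨d⟩` need checking, and each acts as multiplication by an element of the tensor
    -- square, which preserves `I`.
    have hw : w ∈ AddSubgroup.closure (Set.range (WittRing.angle (F := L))) := by
      rw [WittRing.closure_range_angle]; trivial
    induction hw using AddSubgroup.closure_induction with
    | mem w h =>
      obtain ⟨d, rfl⟩ := h
      exact ⟨_, I.mul_mem_left _ hx, (angle_smul_symbol d x).symm⟩
    | zero => exact ⟨0, I.zero_mem, by rw [map_zero, zero_smul]⟩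
    | add a b _ _ ha hb =>
      obtain ⟨y, hy, hy'⟩ := ha
      obtain ⟨z, hz, hz'⟩ := hb
      exact ⟨y + z, I.add_mem hy hz, by rw [map_add, hy', hz', add_smul]⟩
    | neg a _ ha =>
      obtain ⟨y, hy, hy'⟩ := ha
      exact ⟨-y, I.neg_mem hy, by rw [map_neg, hy', neg_smul]⟩

theorem mem_symbolSubmodule {I : Ideal (L ⊗[ℤ] L)} {x : QuadWitt L} :
    x ∈ symbolSubmodule I ↔ ∃ z ∈ I, symbol L z = x := Iff.rfl

/-- It is enough to treat the generators `⟨d⟩ - 1`, which act as multiples of `tensorDiff d`. -/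
theorem fundamentalIdeal_smul_symbolSubmodule_le (I : Ideal (L ⊗[ℤ] L)) :
    WittRing.fundamentalIdeal L • symbolSubmodule I ≤ symbolSubmodule (diffIdeal L L * I) := by
  refine Submodule.smul_le.2 fun r hr n hn => ?_
  obtain ⟨z, hz, rfl⟩ := mem_symbolSubmodule.1 hn
  clear hn
  replace hr := WittRing.fundamentalIdeal_le_span hr
  induction hr using Submodule.span_induction with
  | mem r h =>
    obtain ⟨d, rfl⟩ := h
    exact ⟨_, Ideal.mul_mem_mul (Ideal.subset_span ⟨(d : L), rfl⟩) (I.mul_mem_left _ hz),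
      (angle_sub_one_smul_symbol d z).symm⟩
  | zero => rw [zero_smul]; exact zero_mem _
  | add r r' _ _ h h' => rw [add_smul]; exact add_mem h h'
  | smul a r _ h => rw [smul_eq_mul, mul_smul]; exact Submodule.smul_mem _ _ h

/-- The submodule `I(L)ⁿ W_q(L)` is contained in the image of the `n`-th power of the
diagonal ideal. -/
theorem fundamentalIdeal_pow_smul_top_le (n : ℕ) :
    WittRing.fundamentalIdeal L ^ n • (⊤ : Submodule (WittRing L) (QuadWitt L)) ≤
      symbolSubmodule (diffIdeal L L ^ n) := by
  induction n with
  | zero =>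
    intro x _
    obtain ⟨z, rfl⟩ := symbol_surjective x
    exact ⟨z, by simp, rfl⟩
  | succ n ih =>
    have h : diffIdeal L L ^ (n + 1) = diffIdeal L L * diffIdeal L L ^ n :=
      pow_succ' (M := Ideal (L ⊗[ℤ] L)) _ n
    rw [h, pow_succ', mul_smul]
    exact (smul_mono_right _ ih).trans (fundamentalIdeal_smul_symbolSubmodule_le _)

end QuadWitt

end Symbol

/-! ### Reduction of the transfer to generators -/

section TransferSymbol

variable {F L : Type u} [Field F] [Field L] [Algebra F L] [FiniteDimensional F L]

/-- The functional `s` is `F`-linear, so a scalar of `F` comes out of `s ∘ q`. -/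
theorem scharlauTransfer_angle_smul (s : L →ₗ[F] F) (hs : s ≠ 0) (d : Fˣ) (x : QuadWitt L) :
    scharlauTransfer s hs (WittRing.angle (Units.map (algebraMap F L).toMonoidHom d) • x) =
      WittRing.angle d • scharlauTransfer s hs x := by
  induction x using QuadWitt.ind with | _ X
  rw [QuadWitt.angle_smul_mk, scharlauTransfer_mk, scharlauTransfer_mk, QuadWitt.angle_smul_mk]
  let _ : Module F X.carrier := Module.restrictScalars F L X.carrier
  refine QuadWitt.mk_eq_of_isometry ⟨⟨LinearEquiv.refl F X.carrier, fun x => ?_⟩⟩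
  change (d : F) * s (X.form x) = s (algebraMap F L d * X.form x)
  rw [← Algebra.smul_def, map_smul, smul_eq_mul]

variable [CharP L 2]

open QuadWitt

/-- Each difference of an element `d` of `F` is, up to a unit of the tensor square, the action of
`⟨d⟩ - 1`, and this factor comes out of the transfer. Iteration turns powers of `diffIdeal F L` into
powers of `I(F)`. -/
theorem scharlauTransfer_diffIdeal_mul (s : L →ₗ[F] F) (hs : s ≠ 0) {I : Ideal (L ⊗[ℤ] L)}
    {P : Submodule (WittRing F) (QuadWitt F)}
    (hP : ∀ z ∈ I, scharlauTransfer s hs (symbol L z) ∈ P) {z : L ⊗[ℤ] L}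
    (hz : z ∈ diffIdeal F L * I) :
    scharlauTransfer s hs (symbol L z) ∈ WittRing.fundamentalIdeal F • P := by
  have key : ∀ (d : F) (y : L ⊗[ℤ] L), y ∈ I →
      scharlauTransfer s hs (symbol L (tensorDiff (algebraMap F L d) * y)) ∈
        WittRing.fundamentalIdeal F • P := by
    intro d y hy
    by_cases hd : d = 0
    · subst hd
      simp [tensorDiff]
    lift d to Fˣ using Ne.isUnit hd
    let d' : Lˣ := Units.map (algebraMap F L).toMonoidHom d
    -- The factor `1 ⊗ d⁻¹` in the action of `⟨d⟩ - 1` is compensated by applying that action to `(1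
    -- ⊗ d) y`, which is still in `I`.
    have h1 : (1 ⊗ₜ (d' : L)⁻¹ : L ⊗[ℤ] L) * ((1 ⊗ₜ (d' : L)) * y) = y := by
      rw [← mul_assoc, Algebra.TensorProduct.tmul_mul_tmul, one_mul,
        inv_mul_cancel₀ d'.ne_zero, ← Algebra.TensorProduct.one_def, one_mul]
    have h2 := angle_sub_one_smul_symbol d' ((1 ⊗ₜ (d' : L)) * y)
    rw [h1] at h2
    change scharlauTransfer s hs (symbol L (tensorDiff (d' : L) * y)) ∈ _
    rw [← h2, sub_smul, one_smul, map_sub, scharlauTransfer_angle_smul]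
    have h3 := Submodule.smul_mem_smul (WittRing.angle_sub_one_mem d)
      (hP _ (I.mul_mem_left (1 ⊗ₜ (d' : L)) hy))
    rwa [sub_smul, one_smul] at h3
  induction hz using Submodule.mul_induction_on' with
  | mem_mul_mem a ha y hy =>
    induction ha using Submodule.span_induction generalizing y with
    | mem a h =>
      obtain ⟨d, rfl⟩ := h
      exact key d y hy
    | zero => simp
    | add a b _ _ ha hb => rw [add_mul, map_add, map_add]; exact add_mem (ha y hy) (hb y hy)
    | smul c a _ h =>
      -- The coefficient `c` is absorbed by the factor in `I`; hence the induction is generalized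
      -- over `y`.
      rw [smul_eq_mul, mul_assoc, mul_left_comm]
      exact h _ (I.mul_mem_left c hy)
  | add a _ b _ ha hb => rw [map_add, map_add]; exact add_mem ha hb

theorem scharlauTransfer_diffIdeal_pow (s : L →ₗ[F] F) (hs : s ≠ 0)
    {P : Submodule (WittRing F) (QuadWitt F)} (hP : ∀ x, scharlauTransfer s hs x ∈ P) (n : ℕ)
    {z : L ⊗[ℤ] L} (hz : z ∈ diffIdeal F L ^ n) :
    scharlauTransfer s hs (symbol L z) ∈ WittRing.fundamentalIdeal F ^ n • P := by
  induction n generalizing z with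
  | zero => simpa using hP _
  | succ n ih =>
    have h : diffIdeal F L ^ (n + 1) = diffIdeal F L * diffIdeal F L ^ n :=
      pow_succ' (M := Ideal (L ⊗[ℤ] L)) _ n
    rw [h] at hz
    rw [pow_succ', mul_smul]
    exact scharlauTransfer_diffIdeal_mul s hs (fun z hz => ih hz) hz

/-- If the `n`-th power of the diagonal ideal is generated, up to squares, by the `k`-th power of
the differences of elements of `F`, then the transfer maps `I(L)ⁿ W_q(L)` to `I(F)ᵏ P`, where `P`
contains all transfers. -/
theorem scharlauTransfer_mem_of_diffIdeal_pow_le (s : L →ₗ[F] F) (hs : s ≠ 0)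
    {P : Submodule (WittRing F) (QuadWitt F)} (hP : ∀ x, scharlauTransfer s hs x ∈ P) {n k : ℕ}
    (h : diffIdeal L L ^ n ≤ diffIdeal F L ^ k ⊔ squareIdeal L) {x : QuadWitt L}
    (hx : x ∈ WittRing.fundamentalIdeal L ^ n • (⊤ : Submodule (WittRing L) (QuadWitt L))) :
    scharlauTransfer s hs x ∈ WittRing.fundamentalIdeal F ^ k • P := by
  obtain ⟨z, hz, rfl⟩ := mem_symbolSubmodule.1 (fundamentalIdeal_pow_smul_top_le n hx)
  obtain ⟨y, hy, w, hw, rfl⟩ := Submodule.mem_sup.1 (h hz)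
  rw [map_add, symbol_eq_zero_of_mem_squareIdeal hw, add_zero]
  exact scharlauTransfer_diffIdeal_pow s hs hP k hy

end TransferSymbol

/-! ### Powers of ideals modulo a given ideal -/

section Ideals

variable {R : Type*} [CommRing R]

theorem ideal_pow_le_pow_sup {J K N : Ideal R} (h : J ≤ K ⊔ N) (n : ℕ) : J ^ n ≤ K ^ n ⊔ N := by
  induction n with
  | zero => simp
  | succ n ih =>
    rw [pow_succ, pow_succ]
    refine (Ideal.mul_mono ih h).trans ?_
    rw [Ideal.sup_mul, Ideal.mul_sup]
    refine sup_le (sup_le le_sup_left (le_sup_of_le_right ?_)) (le_sup_of_le_right ?_)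
    · exact Ideal.mul_le_right
    · exact Ideal.mul_le_left

/-- Modulo `N` the generator `x` has square zero, so a product of `n + 1` factors involves it at
most once and keeps at least `n` factors from `K`. -/
theorem ideal_pow_succ_le_pow_sup {J K N : Ideal R} {x : R} (h : J ≤ K ⊔ Ideal.span {x})
    (hx : x ^ 2 ∈ N) (n : ℕ) : J ^ (n + 1) ≤ K ^ n ⊔ N := by
  set D := Ideal.span {x}
  have hD : D * D ≤ N := by
    rw [Ideal.span_singleton_mul_span_singleton, Ideal.span_singleton_le_iff_mem, ← sq]
    exact hx
  have key : J ^ (n + 1) ≤ K ^ (n + 1) ⊔ K ^ n * D ⊔ N := by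
    induction n with
    | zero => simpa using h.trans le_sup_left
    | succ n ih =>
      rw [pow_succ]
      refine (Ideal.mul_mono ih h).trans ?_
      have h1 : K ^ n * D * K = K ^ (n + 1) * D := by ring
      have h2 : K ^ n * D * D = K ^ n * (D * D) := mul_assoc _ _ _
      rw [Ideal.sup_mul, Ideal.sup_mul, Ideal.mul_sup, Ideal.mul_sup (K ^ n * D), h1, h2,
        ← pow_succ]
      refine sup_le (sup_le le_sup_left (sup_le (le_sup_of_le_left le_sup_right) ?_)) ?_
      · exact le_sup_of_le_right (Ideal.mul_le_right.trans hD)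
      · exact le_sup_of_le_right Ideal.mul_le_left
  refine key.trans (sup_le_sup_right (sup_le ?_ Ideal.mul_le_left) _)
  exact Ideal.pow_le_pow_right n.le_succ

end Ideals

/-! ### Transfers along separable, purely inseparable and simple extensions -/

section Transfers

variable {F L : Type u} [Field F] [Field L] [Algebra F L]

open QuadWitt

theorem polarBilin_compQuadraticMap' {V : Type*} [AddCommGroup V] [Module L V] [Module F V]
    [IsScalarTower F L V] (s : L →ₗ[F] F) (q : QuadraticForm L V) (x y : V) :
    (s.compQuadraticMap' q).polarBilin x y = s (q.polarBilin x y) := by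
  simp [QuadraticMap.polar]

/-- Frobenius reciprocity for a form `[1, b]` defined over `F`: the isometry identifies `L ⊗ F²`
with `L²`, and `s` is linear in the coefficients from `F`. -/
theorem scaledTrace_tensor_binaryForm [CharP F 2] [CharP L 2] (s : L →ₗ[F] F) (a : L) (b : F) :
    (bilinTensorQuad ((LinearMap.mul F L).compr₂ (s ∘ₗ LinearMap.mulLeft F a))
      (binaryForm 1 b)).Equivalent
      (s.compQuadraticMap' (a • binaryForm (1 : L) (algebraMap F L b))) := by
  let e : (L ⊗[F] (F × F)) ≃ₗ[F] (L × L) := TensorProduct.prodRight F F L F F ≪≫ₗ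
    (TensorProduct.rid F L).prodCongr (TensorProduct.rid F L)
  have he : ∀ v w, e (v ⊗ₜ w) = (algebraMap F L w.1 * v, algebraMap F L w.2 * v) := by
    intro v w
    simp [e, Algebra.smul_def]
  have hB : ∀ v v', (LinearMap.mul F L).compr₂ (s ∘ₗ LinearMap.mulLeft F a) v v' =
      s (a * (v * v')) := fun _ _ => rfl
  have hs : ∀ (y : L) (c : F), s y * c = s (algebraMap F L c * y) := fun y c => by
    rw [← Algebra.smul_def, map_smul, smul_eq_mul, mul_comm]
  refine equivalent_of_tensor (fun x y => by rw [hB, hB, mul_comm x]) e ?_ ?_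
  · intro v w
    rw [he, hB, hs, LinearMap.compQuadraticMap'_apply, smul_apply,
      binaryForm_apply, binaryForm_apply]
    congr 1
    simp only [map_add, map_mul, map_pow, map_one, smul_eq_mul]
    ring
  · intro v w v' w'
    rw [polarBilin_compQuadraticMap', he, he, hB, hs, QuadraticMap.polarBilin_apply_apply,
      FunLike.coe_smul, QuadraticMap.polar_smul, ← QuadraticMap.polarBilin_apply_apply,
      binaryForm_polarBilin, binaryForm_polarBilin]
    congr 1
    simp only [map_add, map_mul, smul_eq_mul]
    ring

/-- A separable `x` satisfies `F(x) = F(x²)`, and for algebraic elements the generated field is the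
generated algebra. -/
theorem adjoin_sq_eq_top_of_isSeparable [CharP F 2] [Algebra.IsSeparable F L] :
    Algebra.adjoin F (Set.range fun x : L => x ^ 2) = ⊤ := by
  refine eq_top_iff.2 fun x _ => ?_
  have h := IntermediateField.adjoin_simple_eq_adjoin_pow_expChar_of_isSeparable' F L x 2
  have hx : x ∈ IntermediateField.adjoin F {x ^ 2} :=
    h ▸ IntermediateField.mem_adjoin_simple_self F x
  rw [← IntermediateField.mem_toSubalgebra,
    IntermediateField.adjoin_simple_toSubalgebra_of_isAlgebraic
      (Algebra.IsAlgebraic.isAlgebraic _)] at hx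
  have hs : {x ^ 2} ⊆ Set.range fun x : L => x ^ 2 := Set.singleton_subset_iff.2 ⟨x, rfl⟩
  exact Algebra.adjoin_mono hs hx

variable [FiniteDimensional F L]

/-- The bilinear form `(x, y) ↦ s (a x y)` on `L`. -/
def BilinSpace.scaledTrace (s : L →ₗ[F] F) (hs : s ≠ 0) (a : Lˣ) : BilinSpace F where
  carrier := L
  form := (LinearMap.mul F L).compr₂ (s ∘ₗ LinearMap.mulLeft F (a : L))
  symm x y := by simp [mul_comm x]
  nondegenerate := nondeg_of_symm (fun x y => by simp [mul_comm x]) fun x hx => by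
    by_contra hne
    refine hs (LinearMap.ext fun z => ?_)
    have := hx (x⁻¹ * ((a : L)⁻¹ * z))
    simpa [hne] using this

theorem scharlauTransfer_angle_smul_binary [CharP F 2] [CharP L 2]
    (s : L →ₗ[F] F) (hs : s ≠ 0)
    (a : Lˣ) (b : F) : scharlauTransfer s hs (WittRing.angle a • binary 1 (algebraMap F L b)) =
      WittRing.mk (.scaledTrace s hs a) • binary 1 b := by
  rw [binary, angle_smul_mk, scharlauTransfer_mk, binary, mk_smul]
  refine mk_eq_of_isometry (QuadraticMap.Equivalent.symm ?_)
  refine QuadraticMap.Equivalent.trans (scaledTrace_tensor_binaryForm s (a : L) b) ?_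
  -- The identity map, between the product `F`-structure and the one restricted from `L`.
  let e : (L × L) ≃ₗ[F] (((QuadSpace.binary (1 : L) (algebraMap F L b)).scale a).transfer s
      hs).carrier :=
    { toFun := fun x => x
      invFun := fun x => x
      map_add' := fun _ _ => rfl
      map_smul' := fun c x => by
        change c • x = (algebraMap F L c) • x
        exact (algebraMap_smul L c x).symm
      left_inv := fun _ => rfl
      right_inv := fun _ => rfl }
  exact ⟨⟨e, fun x => rfl⟩⟩

/-- The transfer of a purely inseparable extension of even degree has values in `I(F) W_q(F)`. -/
theorem scharlauTransfer_mem_of_isPurelyInseparable [CharP F 2] [CharP L 2]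
    (s : L →ₗ[F] F) (hs : s ≠ 0) [IsPurelyInseparable F L] (hd : Even (Module.finrank F L))
    (x : QuadWitt L) :
    scharlauTransfer s hs x ∈
      WittRing.fundamentalIdeal F • (⊤ : Submodule (WittRing F) (QuadWitt F)) := by
  have hx : x ∈ AddSubgroup.closure (Set.range fun z : L × L => binary z.1 z.2) := by
    rw [closure_range_binary]; trivial
  induction hx using AddSubgroup.closure_induction with
  | mem x h =>
    obtain ⟨⟨a, c⟩, rfl⟩ := h
    by_cases ha : a = 0
    · subst ha
      simp only
      rw [binary_comm, binary_zero_right, map_zero]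
      exact zero_mem _
    lift a to Lˣ using Ne.isUnit ha
    obtain ⟨n, b, hb⟩ := IsPurelyInseparable.pow_mem F 2 ((a : L) * c)
    -- This gives `[a, c] = ⟨a⟩[1, ac]`; raising `ac` to the power `2^n` then moves the second slot
    -- into `F`.
    have h := angle_smul_binary a 1 ((a : L) * c)
    rw [mul_one, inv_mul_cancel_left₀ ha, ← binary_one_pow_two_pow _ n, ← hb] at h
    simp only
    rw [← h, scharlauTransfer_angle_smul_binary]
    refine Submodule.smul_mem_smul ?_ Submodule.mem_top
    rw [WittRing.fundamentalIdeal, RingHom.mem_ker, WittRing.dimIndex_mk]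
    exact (ZMod.natCast_eq_zero_iff_even).2 hd
  | zero => rw [map_zero]; exact zero_mem _
  | add x y _ _ hx hy => rw [map_add]; exact add_mem hx hy
  | neg x _ hx => rw [map_neg]; exact neg_mem hx

/-- The single generator `tensorDiff α`, of square zero modulo `squareIdeal`, costs one power of
`I(F)`. It is recovered by taking for `P` the submodule `I(F) W_q(F)`, which contains all transfers.
-/
theorem scharlauTransfer_pow_of_isPurelyInseparable [CharP F 2] [CharP L 2]
    (s : L →ₗ[F] F) (hs : s ≠ 0) [IsPurelyInseparable F L] (hd : Even (Module.finrank F L)) {α : L}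
    (hα : Algebra.adjoin F {α} = ⊤) (n : ℕ) {x : QuadWitt L}
    (hx : x ∈ WittRing.fundamentalIdeal L ^ n • (⊤ : Submodule (WittRing L) (QuadWitt L))) :
    scharlauTransfer s hs x ∈
      WittRing.fundamentalIdeal F ^ n • (⊤ : Submodule (WittRing F) (QuadWitt F)) := by
  cases n with
  | zero => simp
  | succ n =>
    rw [pow_succ, mul_smul]
    refine scharlauTransfer_mem_of_diffIdeal_pow_le s hs
      (scharlauTransfer_mem_of_isPurelyInseparable s hs hd) ?_ hx
    have hJ : diffIdeal L L ≤ diffIdeal F L ⊔ Ideal.span {tensorDiff α} := by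
      refine diffIdeal_self_le le_sup_left ?_ hα
      rintro _ rfl
      exact Ideal.mem_sup_right (Ideal.mem_span_singleton_self _)
    exact ideal_pow_succ_le_pow_sup hJ (tensorDiff_sq α ▸ tensorDiff_sq_mem α) n

/-- When `L` is generated over `F` by squares, the differences from `F` generate the diagonal ideal
modulo `squareIdeal`, so no power is lost. -/
theorem scharlauTransfer_pow_of_adjoin_sq [CharP L 2] (s : L →ₗ[F] F) (hs : s ≠ 0)
    (h : Algebra.adjoin F (Set.range fun x : L => x ^ 2) = ⊤) (n : ℕ) {x : QuadWitt L}
    (hx : x ∈ WittRing.fundamentalIdeal L ^ n • (⊤ : Submodule (WittRing L) (QuadWitt L))) :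
    scharlauTransfer s hs x ∈
      WittRing.fundamentalIdeal F ^ n • (⊤ : Submodule (WittRing F) (QuadWitt F)) := by
  have hJ : diffIdeal L L ≤ diffIdeal F L ⊔ squareIdeal L := by
    refine diffIdeal_self_le le_sup_left ?_ h
    rintro _ ⟨y, rfl⟩
    exact Ideal.mem_sup_right (tensorDiff_sq_mem y)
  exact scharlauTransfer_mem_of_diffIdeal_pow_le s hs (fun _ => Submodule.mem_top)
    (ideal_pow_le_pow_sup hJ n) hx

theorem scharlauTransfer_trans {E : Type u} [Field E] [Algebra F E] [Algebra E L]
    [IsScalarTower F E L] [FiniteDimensional F E] [FiniteDimensional E L]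
    (r : E →ₗ[F] F) (hr : r ≠ 0) (t : L →ₗ[E] E) (ht : t ≠ 0)
    (hrt : r ∘ₗ t.restrictScalars F ≠ 0) (x : QuadWitt L) :
    scharlauTransfer (r ∘ₗ t.restrictScalars F) hrt x =
      scharlauTransfer r hr (scharlauTransfer t ht x) := by
  induction x using QuadWitt.ind with | _ X
  rw [scharlauTransfer_mk, scharlauTransfer_mk, scharlauTransfer_mk]
  have hsmul : ∀ (c : F) (x : X.carrier),
      algebraMap F L c • x = algebraMap E L (algebraMap F E c) • x := fun c x => by
    rw [← IsScalarTower.algebraMap_apply]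
  let e : (X.transfer (r ∘ₗ t.restrictScalars F) hrt).carrier ≃ₗ[F]
      ((X.transfer t ht).transfer r hr).carrier :=
    { toFun := fun x => x
      invFun := fun x => x
      map_add' := fun _ _ => rfl
      map_smul' := hsmul
      left_inv := fun _ => rfl
      right_inv := fun _ => rfl }
  exact mk_eq_of_isometry ⟨⟨e, fun x => rfl⟩⟩

/-- Here `s ∘ q = s₀ ∘ (u q)`: changing the functional amounts to twisting by `⟨u⟩`. -/
theorem scharlauTransfer_comp_mulLeft (s₀ s : L →ₗ[F] F) (hs₀ : s₀ ≠ 0) (hs : s ≠ 0) (u : Lˣ)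
    (h : s = s₀ ∘ₗ LinearMap.mulLeft F (u : L)) (x : QuadWitt L) :
    scharlauTransfer s hs x = scharlauTransfer s₀ hs₀ (WittRing.angle u • x) := by
  subst h
  induction x using QuadWitt.ind with | _ X
  rw [angle_smul_mk, scharlauTransfer_mk, scharlauTransfer_mk]
  let e : (X.transfer (s₀ ∘ₗ LinearMap.mulLeft F (u : L)) hs).carrier ≃ₗ[F]
      ((X.scale u).transfer s₀ hs₀).carrier :=
    { toFun := fun x => x
      invFun := fun x => x
      map_add' := fun _ _ => rfl
      map_smul' := fun _ _ => rfl
      left_inv := fun _ => rfl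
      right_inv := fun _ => rfl }
  exact mk_eq_of_isometry ⟨⟨e, fun x => rfl⟩⟩

/-- The dual of `L` over `F` is a line over `L`: the map `u ↦ s₀ (u ·)` is injective, hence
bijective by dimension. -/
theorem exists_unit_comp_mulLeft_eq {s₀ s : L →ₗ[F] F} (hs₀ : s₀ ≠ 0) (hs : s ≠ 0) :
    ∃ u : Lˣ, s = s₀ ∘ₗ LinearMap.mulLeft F (u : L) := by
  let f : L →ₗ[F] Module.Dual F L := (LinearMap.mul F L).compr₂ s₀
  have hf : Function.Injective f := by
    rw [injective_iff_map_eq_zero]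
    intro x hx
    by_contra hne
    refine hs₀ (LinearMap.ext fun z => ?_)
    have : s₀ (x * (x⁻¹ * z)) = 0 := LinearMap.congr_fun hx (x⁻¹ * z)
    rwa [mul_inv_cancel_left₀ hne] at this
  obtain ⟨u, hu⟩ := (LinearMap.injective_iff_surjective_of_finrank_eq_finrank
    (Subspace.dual_finrank_eq (K := F) (V := L)).symm).1 hf s
  have hu0 : u ≠ 0 := by
    rintro rfl
    exact hs (by rw [← hu, map_zero])
  exact ⟨Units.mk0 u hu0, hu.symm⟩

/-- The transfer of a simple extension that is purely inseparable of even degree over an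
intermediate separable extension respects the filtration by the powers of the fundamental ideal. -/
theorem scharlauTransfer_pow_of_tower [CharP F 2] [CharP L 2]
    (E : Type u) [Field E] [Algebra F E] [Algebra E L]
    [IsScalarTower F E L] [FiniteDimensional F E] [FiniteDimensional E L]
    [Algebra.IsSeparable F E] [IsPurelyInseparable E L] (hd : Even (Module.finrank E L))
    (s : L →ₗ[F] F) (hs : s ≠ 0) {α : L} (hα : Algebra.adjoin F {α} = ⊤) (n : ℕ) {x : QuadWitt L}
    (hx : x ∈ WittRing.fundamentalIdeal L ^ n • (⊤ : Submodule (WittRing L) (QuadWitt L))) :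
    scharlauTransfer s hs x ∈
      WittRing.fundamentalIdeal F ^ n • (⊤ : Submodule (WittRing F) (QuadWitt F)) := by
  have : CharP E 2 := charP_of_injective_algebraMap (algebraMap F E).injective 2
  have hα' : Algebra.adjoin E {α} = ⊤ := by
    have h : Algebra.adjoin F {α} ≤ (Algebra.adjoin E {α}).restrictScalars F :=
      Algebra.adjoin_le Algebra.subset_adjoin
    rw [hα] at h
    exact eq_top_iff.2 fun y _ => h Algebra.mem_top
  obtain ⟨r, hr⟩ : ∃ r : E →ₗ[F] F, r ≠ 0 := exists_ne (0 : Module.Dual F E)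
  obtain ⟨t, ht⟩ : ∃ t : L →ₗ[E] E, t ≠ 0 := exists_ne (0 : Module.Dual E L)
  have hrt : r ∘ₗ t.restrictScalars F ≠ 0 := by
    intro h
    obtain ⟨y, hy⟩ : ∃ y, t y ≠ 0 := by
      by_contra! h'
      exact ht (LinearMap.ext h')
    refine hr (LinearMap.ext fun z => ?_)
    have := LinearMap.congr_fun h ((z * (t y)⁻¹) • y)
    rw [LinearMap.comp_apply, LinearMap.restrictScalars_apply, map_smul, smul_eq_mul,
      inv_mul_cancel_right₀ hy] at this
    exact this
  -- The given `s` need not factor through `E` as `r ∘ t`, but does so after multiplication by a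
  -- unit.
  obtain ⟨u, hu⟩ := exists_unit_comp_mulLeft_eq hrt hs
  rw [scharlauTransfer_comp_mulLeft _ s hrt hs u hu, scharlauTransfer_trans r hr t ht]
  exact scharlauTransfer_pow_of_adjoin_sq r hr adjoin_sq_eq_top_of_isSeparable n
    (scharlauTransfer_pow_of_isPurelyInseparable t ht hd hα' n (Submodule.smul_mem _ _ hx))

/-- The transfer of a finite simple extension in characteristic two respects the filtration by
the powers of the fundamental ideal. -/
theorem scharlauTransfer_mem_pow_smul [CharP F 2] [CharP L 2]
    (s : L →ₗ[F] F) (hs : s ≠ 0) {α : L}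
    (hα : Algebra.adjoin F {α} = ⊤) (n : ℕ) {x : QuadWitt L}
    (hx : x ∈ WittRing.fundamentalIdeal L ^ n • (⊤ : Submodule (WittRing L) (QuadWitt L))) :
    scharlauTransfer s hs x ∈
      WittRing.fundamentalIdeal F ^ n • (⊤ : Submodule (WittRing F) (QuadWitt F)) := by
  by_cases hsep : Algebra.IsSeparable F L
  · exact scharlauTransfer_pow_of_adjoin_sq s hs adjoin_sq_eq_top_of_isSeparable n hx
  refine scharlauTransfer_pow_of_tower (separableClosure F L) ?_ s hs hα n hx
  have := expChar_of_injective_algebraMap (algebraMap F (separableClosure F L)).injective 2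
  obtain ⟨k, hk⟩ := IsPurelyInseparable.finrank_eq_pow (F := separableClosure F L) L 2
  rw [hk]
  -- The degree over the separable closure is `2^k`, and `k = 0` would make `L` separable over `F`,
  -- a case already settled.
  refine Nat.even_pow.2 ⟨even_two, ?_⟩
  rintro rfl
  exact hsep ((separableClosure.eq_top_iff F L).1
    (IntermediateField.finrank_eq_one_iff_eq_top.1 hk))

end Transfers

end WittTheory

end

theorem lemma4p1 {F : Type*} [Field F] [CharP F 2] {p : Polynomial F} [Fact (Irreducible p)]
    (hp : p.Monic) (m : ℕ) (hm : 1 ≤ m) :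
    (WittTheory.polyTransfer hp) '' (WittTheory.Iq (AdjoinRoot p) m : Set _) ⊆
      (WittTheory.Iq F m : Set (WittTheory.QuadWitt F)) := by
  rintro _ ⟨x, hx, rfl⟩
  have : FiniteDimensional F (AdjoinRoot p) := hp.finite_adjoinRoot
  have : CharP (AdjoinRoot p) 2 :=
    charP_of_injective_algebraMap (algebraMap F (AdjoinRoot p)).injective 2
  -- Of the functional `topCoeff hp` only its being nonzero matters. The exponent is `m - 1` by the
  -- definition of `Iq`.
  exact WittTheory.scharlauTransfer_mem_pow_smul _ _ AdjoinRoot.adjoinRoot_eq_top (m - 1) hx
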